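/- All locally convex spaces are Hausdorff locally convex real topological vector spaces. Let $r\in\{0,1,2,\ldots\}\cup\{\infty\}$ and let $E$ be a locally convex space. If $r=0$, let $M$ be a paracompact, locally compact, non-compact Hausdorff topological space; if $r>0$, let $M$ be a metrizable, non-compact, finite-dimensional $C^r$-manifold. If $F$ is a locally convex space, $C^0(M,F)$ denotes the space of continuous maps $M\to F$ with the compact-open topology; for $r>0$, $C^r(M,F)$ denotes the space of $C^r$-maps $M\to F$ (maps whose partial derivatives of order at most $r$ in charts exist and are continuous), with the compact-open $C^r$-topology, i.e. the topology of uniform convergence, on compact sets in charts, of all partial derivatives of order at most $r$ (of all orders, if $r=\infty$). For compact $K\subseteq M$, the subspace $C^r_K(M,F)$ of all $\gamma\in C^r(M,F)$ with $\operatorname{supp}(\gamma)\subseteq K$ carries the induced topology, and $C^r_c(M,F)=\bigcup_K C^r_K(M,F)$ carries the locally convex direct limit topology. Write $C^r_c(M):=C^r_c(M,\mathbb R)$. A bilinear map $\beta\colon E_1\times E_2\to F$ between locally convex spaces is called hypocontinuous if it is separately continuous and its restrictions to $B_1\times E_2$ and to $E_1\times B_2$ are continuous for all bounded sets $B_1\subseteq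 E_1$ and $B_2\subseteq E_2$. For an infinite cardinal $\theta$, the space $E$ is said to have the $\theta$-neighbourhood property if for every set $P$ of continuous seminorms on $E$ of cardinality $|P|\le\theta$ there is a continuous seminorm $q$ on $E$ such that for every $p\in P$ there is $C>0$ with $p\le Cq$ pointwise. Let $\theta(M)$, the compact covering number of $M$, be the smallest cardinality of a cover of $M$ by compact sets (it is infinite, as $M$ is non-compact). Theorem B. The map $$\Psi_{c,E}\colon C^r_c(M)\times E\to C^r_c(M,E),\qquad (\gamma,v)\mapsto \gamma v,\quad (\gamma v)(x):=\gamma(x)v,$$ is a hypocontinuous bilinear map. The map $\Psi_{c,E}$ is continuous if and only if $E$ has the $\theta(M)$-neighbourhood property. If $E$ is metrizable, then $\Psi_{c,E}$ is continuous if and only if $E$ is normable. -/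

import Mathlib

open Filter Topology Set

universe u v w

noncomputable section

/-! ### Locally convex spaces: seminorms, normability, hypocontinuity -/

/-- The pre-order on seminorms: `p ≼ q` if `p ≤ C q` pointwise for some `C > 0`. -/
def SeminormDominated {E : Type u} [AddCommGroup E] [Module ℝ E] (p q : Seminorm ℝ E) : Prop :=
  ∃ C : ℝ, 0 < C ∧ ∀ x : E, p x ≤ C * q x

/-- The `θ`-neighbourhood property: every set of at most `θ` continuous seminorms on `E` has an
upper bound among the continuous seminorms, with respect to the pre-order `≼`. (The lifts only
serve to compare cardinals that live in different universes.) -/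
def HasNeighbourhoodProperty (θ : Cardinal.{v}) (E : Type u) [AddCommGroup E] [Module ℝ E]
    [TopologicalSpace E] : Prop :=
  ∀ P : Set (Seminorm ℝ E), (∀ p ∈ P, Continuous p) →
    Cardinal.lift.{v} (Cardinal.mk P) ≤ Cardinal.lift.{u} θ →
    ∃ q : Seminorm ℝ E, Continuous q ∧ ∀ p ∈ P, SeminormDominated p q

/-- `E` is normable: its topology is the one defined by some norm on `E`. -/
def IsNormable (E : Type u) [AddCommGroup E] [Module ℝ E] [TopologicalSpace E] : Prop :=
  ∃ p : Seminorm ℝ E, (∀ x : E, p x = 0 → x = 0) ∧ WithSeminorms (fun _ : Unit => p)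

/-- Hypocontinuity (in both arguments) of a bilinear map: it is separately continuous, and its
restrictions to `B × E₂` and to `E₁ × B` are continuous for all bounded sets `B`. -/
def IsHypocontinuous {E₁ : Type u} {E₂ : Type v} {F : Type w}
    [AddCommGroup E₁] [Module ℝ E₁] [TopologicalSpace E₁]
    [AddCommGroup E₂] [Module ℝ E₂] [TopologicalSpace E₂]
    [AddCommGroup F] [Module ℝ F] [TopologicalSpace F]
    (β : E₁ →ₗ[ℝ] E₂ →ₗ[ℝ] F) : Prop :=
  (∀ x : E₁, Continuous fun y : E₂ => β x y) ∧
  (∀ y : E₂, Continuous fun x : E₁ => β x y) ∧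
  (∀ B : Set E₁, Bornology.IsVonNBounded ℝ B →
    ContinuousOn (fun z : E₁ × E₂ => β z.1 z.2) (B ×ˢ (univ : Set E₂))) ∧
  (∀ B : Set E₂, Bornology.IsVonNBounded ℝ B →
    ContinuousOn (fun z : E₁ × E₂ => β z.1 z.2) ((univ : Set E₁) ×ˢ B))

/-- The locally convex direct limit topology: the finest locally convex vector topology on `V`
that makes all the linear maps `f i : W i → V` continuous. (In the lattice of topologies on `V`,
smaller means finer.) -/
@[reducible] def lcLimitTopology {ι : Type*} {W : ι → Type*} {V : Type*}
    [∀ i, AddCommGroup (W i)] [∀ i, Module ℝ (W i)] [∀ i, TopologicalSpace (W i)]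
    [AddCommGroup V] [Module ℝ V] (f : ∀ i, W i →ₗ[ℝ] V) : TopologicalSpace V :=
  sInf {t : TopologicalSpace V | (∀ i, Continuous[inferInstance, t] (f i)) ∧
    @IsTopologicalAddGroup V t _ ∧ @ContinuousSMul ℝ V _ _ t ∧
    @LocallyConvexSpace ℝ V _ _ _ _ t}

/-! ### The compact covering number -/

/-- The smallest cardinality of a cover of `M` by compact sets. -/
def compactCoveringNumber (M : Type v) [TopologicalSpace M] : Cardinal.{v} :=
  sInf {κ : Cardinal.{v} | ∃ S : Set (Set M), (∀ K ∈ S, IsCompact K) ∧ ⋃₀ S = univ ∧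
    Cardinal.mk S = κ}

/-! ### Compactly supported elements of a topologized space of functions -/

section CompactSupport

variable {M : Type*} {E : Type*} {X : Type*} [TopologicalSpace M] [AddCommGroup E] [Module ℝ E]
  [AddCommGroup X] [Module ℝ X]

/-- The elements of a space `X` of functions `M → E` whose support is contained in `K`. Here
`ev` sends an element of `X` to the underlying function. -/
def supportedIn (ev : X →ₗ[ℝ] (M → E)) (K : TopologicalSpace.Compacts M) : Submodule ℝ X where
  carrier := {γ | tsupport (ev γ) ⊆ K}
  zero_mem' := by simp
  add_mem' {a b} ha hb := by
    simp only [mem_ofPred_eq, map_add] at *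
    exact (tsupport_add _ _).trans (union_subset ha hb)
  smul_mem' c a ha := by
    simp only [mem_ofPred_eq, map_smul] at *
    exact (closure_mono (Function.support_const_smul_subset c (ev a))).trans ha

/-- The elements of a space `X` of functions `M → E` that have compact support. -/
def functionsWithCompactSupport (ev : X →ₗ[ℝ] (M → E)) : Submodule ℝ X where
  carrier := {γ | HasCompactSupport (ev γ)}
  zero_mem' := by simp [HasCompactSupport.zero]
  add_mem' {a b} ha hb := by
    simp only [mem_ofPred_eq, map_add] at *
    exact ha.add hb
  smul_mem' c a ha := by
    simp only [mem_ofPred_eq, map_smul] at *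
    exact ha.mono (Function.support_const_smul_subset c (ev a))

theorem supportedIn_le (ev : X →ₗ[ℝ] (M → E))
    (K : TopologicalSpace.Compacts M) : supportedIn ev K ≤ functionsWithCompactSupport ev :=
  fun _ hγ => K.isCompact.of_isClosed_subset (isClosed_tsupport _) hγ

/-- The space of compactly supported elements of `X`, as a type of its own: it does not carry the
topology induced by `X`, but the locally convex direct limit topology. -/
def TestFunctions (ev : X →ₗ[ℝ] (M → E)) : Type _ := functionsWithCompactSupport ev

instance (ev : X →ₗ[ℝ] (M → E)) : AddCommGroup (TestFunctions ev) :=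
  inferInstanceAs (AddCommGroup (functionsWithCompactSupport ev))

instance (ev : X →ₗ[ℝ] (M → E)) : Module ℝ (TestFunctions ev) :=
  inferInstanceAs (Module ℝ (functionsWithCompactSupport ev))

/-- The inclusion of the space of functions supported in `K` into the space of all compactly
supported functions. -/
def TestFunctions.incl (ev : X →ₗ[ℝ] (M → E)) (K : TopologicalSpace.Compacts M) :
    supportedIn ev K →ₗ[ℝ] TestFunctions ev :=
  Submodule.inclusion (supportedIn_le ev K)

/-- The compactly supported functions carry the locally convex direct limit topology of the
subspaces of functions supported in a compact set `K`, with the topologies induced by `X`. -/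
instance [TopologicalSpace X] (ev : X →ₗ[ℝ] (M → E)) : TopologicalSpace (TestFunctions ev) :=
  lcLimitTopology (TestFunctions.incl ev)

/-- A bilinear map `m` of the form `(γ, v) ↦ γ v`, restricted to compactly supported functions. -/
def TestFunctions.smulRight {Y : Type*} [AddCommGroup Y] [Module ℝ Y]
    (ev₁ : X →ₗ[ℝ] (M → ℝ)) (ev₂ : Y →ₗ[ℝ] (M → E)) (m : X →ₗ[ℝ] E →ₗ[ℝ] Y)
    (hm : ∀ γ v, ev₂ (m γ v) = fun x => ev₁ γ x • v) :
    TestFunctions ev₁ →ₗ[ℝ] E →ₗ[ℝ] TestFunctions ev₂ :=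
  LinearMap.mk₂ ℝ
    (fun (γ : functionsWithCompactSupport ev₁) v => (⟨m γ.1 v, by
      have h : HasCompactSupport (ev₁ γ.1) := γ.2
      change HasCompactSupport (ev₂ (m γ.1 v))
      rw [hm]
      refine h.mono fun x hx => ?_
      simp only [Function.mem_support] at hx ⊢
      intro h0
      exact hx (by rw [h0, zero_smul])⟩ : functionsWithCompactSupport ev₂))
    (fun a b v => Subtype.ext (by
      change m (a.1 + b.1) v = m a.1 v + m b.1 v
      simp))
    (fun c a v => Subtype.ext (by
      change m (c • a.1) v = c • m a.1 v
      simp))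
    (fun a v w => Subtype.ext (by
      change m a.1 (v + w) = m a.1 v + m a.1 w
      simp))
    (fun c a v => Subtype.ext (by
      change m a.1 (c • v) = c • m a.1 v
      simp))

end CompactSupport

/-! ### The case `r = 0`: continuous functions on a topological space -/

section Continuous

variable (M : Type*) (E : Type*) [TopologicalSpace M] [AddCommGroup E] [Module ℝ E]
  [TopologicalSpace E] [IsTopologicalAddGroup E] [ContinuousSMul ℝ E]

/-- The underlying function of a continuous map. The space `C(M, E)` carries the compact-open
topology. -/
def contEval : C(M, E) →ₗ[ℝ] (M → E) where
  toFun γ := γ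
  map_add' _ _ := rfl
  map_smul' _ _ := rfl

/-- The space of compactly supported continuous functions `M → E`, with the locally convex direct
limit topology. -/
abbrev ContTestFunctions : Type _ := TestFunctions (contEval M E)

/-- The bilinear map `(γ, v) ↦ γ v` from `C(M, ℝ) × E` to `C(M, E)`. -/
def contSMulRight : C(M, ℝ) →ₗ[ℝ] E →ₗ[ℝ] C(M, E) :=
  LinearMap.mk₂ ℝ
    (fun γ v => ⟨fun x => γ x • v, γ.continuous.smul continuous_const⟩)
    (fun a b v => by ext x; simp [add_smul])
    (fun c a v => by ext x; simp [mul_smul])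
    (fun a v w => by ext x; simp)
    (fun c a v => by ext x; simp [smul_comm c])

/-- The bilinear map `(γ, v) ↦ γ v` on compactly supported continuous functions. -/
def contPsi : ContTestFunctions M ℝ →ₗ[ℝ] E →ₗ[ℝ] ContTestFunctions M E :=
  TestFunctions.smulRight (contEval M ℝ) (contEval M E) (contSMulRight M E) (fun _ _ => rfl)

end Continuous

/-! ### Vector-valued `C^r`-maps on open subsets of `ℝⁿ` -/

section PartialDerivatives

variable {n : ℕ} {E : Type*} [AddCommGroup E] [Module ℝ E] [TopologicalSpace E]

/-- `f` has the partial derivative `f'` in the `i`-th direction at the point `x`. -/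
def HasPartialDeriv (i : Fin n) (f : EuclideanSpace ℝ (Fin n) → E) (f' : E)
    (x : EuclideanSpace ℝ (Fin n)) : Prop :=
  Tendsto (fun t : ℝ => t⁻¹ • (f (x + t • EuclideanSpace.single i (1 : ℝ)) - f x))
    (𝓝[≠] 0) (𝓝 f')

open Classical in
/-- The `i`-th partial derivative of `f` (with value `0` where it does not exist). -/
def partialDeriv (i : Fin n) (f : EuclideanSpace ℝ (Fin n) → E)
    (x : EuclideanSpace ℝ (Fin n)) : E :=
  if h : ∃ f', HasPartialDeriv i f f' x then h.choose else 0

/-- The iterated partial derivative of `f` along a finite sequence of directions. -/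
def iteratedPartialDeriv (l : List (Fin n)) (f : EuclideanSpace ℝ (Fin n) → E) :
    EuclideanSpace ℝ (Fin n) → E :=
  l.foldr partialDeriv f

/-- `f` is `C^r` on the open set `U`: all iterated partial derivatives of order at most `r` exist
and are continuous on `U`. -/
def IsCrOn (r : ℕ∞) (U : Set (EuclideanSpace ℝ (Fin n)))
    (f : EuclideanSpace ℝ (Fin n) → E) : Prop :=
  ∀ l : List (Fin n), (l.length : ℕ∞) ≤ r →
    ContinuousOn (iteratedPartialDeriv l f) U ∧
    ((l.length : ℕ∞) < r → ∀ i : Fin n, ∀ x ∈ U,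
      ∃ f', HasPartialDeriv i (iteratedPartialDeriv l f) f' x)

theorem HasPartialDeriv.partialDeriv_eq [T2Space E] {i : Fin n}
    {f : EuclideanSpace ℝ (Fin n) → E} {f' : E} {x : EuclideanSpace ℝ (Fin n)}
    (h : HasPartialDeriv i f f' x) : partialDeriv i f x = f' := by
  have h' : ∃ f', HasPartialDeriv i f f' x := ⟨f', h⟩
  rw [partialDeriv, dif_pos h']
  exact tendsto_nhds_unique h'.choose_spec h

theorem HasPartialDeriv.congr_on {i : Fin n} {f g : EuclideanSpace ℝ (Fin n) → E} {f' : E}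
    {x : EuclideanSpace ℝ (Fin n)} {U : Set (EuclideanSpace ℝ (Fin n))} (hU : IsOpen U)
    (hx : x ∈ U) (hfg : EqOn g f U) (h : HasPartialDeriv i f f' x) :
    HasPartialDeriv i g f' x := by
  refine Tendsto.congr' ?_ h
  have hc : Continuous fun t : ℝ => x + t • EuclideanSpace.single i (1 : ℝ) := by fun_prop
  have : ∀ᶠ t : ℝ in 𝓝 0, x + t • EuclideanSpace.single i (1 : ℝ) ∈ U :=
    hc.continuousAt.eventually_mem (by simpa using hU.mem_nhds hx)
  filter_upwards [this.filter_mono nhdsWithin_le_nhds] with t ht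
  rw [hfg ht, hfg hx]

theorem IsCrOn.exists_deriv {r : ℕ∞} {U : Set (EuclideanSpace ℝ (Fin n))}
    {f : EuclideanSpace ℝ (Fin n) → E} (hf : IsCrOn r U f) {i : Fin n} {l : List (Fin n)}
    (hl : ((i :: l).length : ℕ∞) ≤ r) {x : EuclideanSpace ℝ (Fin n)} (hx : x ∈ U) :
    HasPartialDeriv i (iteratedPartialDeriv l f) (iteratedPartialDeriv (i :: l) f x) x := by
  have hlt : (l.length : ℕ∞) < r :=
    lt_of_lt_of_le (by exact_mod_cast Nat.lt_succ_self l.length) hl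
  have h := (hf l hlt.le).2 hlt i x hx
  have e : iteratedPartialDeriv (i :: l) f x = h.choose := by
    change partialDeriv i (iteratedPartialDeriv l f) x = _
    rw [partialDeriv, dif_pos h]
  rw [e]
  exact h.choose_spec

/-- Iterated partial derivatives commute with operations that preserve partial derivatives. -/
theorem IsCrOn.of_op [T2Space E] {F G : Type*} [AddCommGroup F] [Module ℝ F] [TopologicalSpace F]
    [AddCommGroup G] [Module ℝ G] [TopologicalSpace G]
    {r : ℕ∞} {U : Set (EuclideanSpace ℝ (Fin n))} (hU : IsOpen U)
    {f : EuclideanSpace ℝ (Fin n) → F} {g : EuclideanSpace ℝ (Fin n) → G}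
    (op : F → G → E) (hop : Continuous fun z : F × G => op z.1 z.2)
    (hder : ∀ (i : Fin n) (a : EuclideanSpace ℝ (Fin n) → F) (b : EuclideanSpace ℝ (Fin n) → G)
      (a' : F) (b' : G) (x : EuclideanSpace ℝ (Fin n)), HasPartialDeriv i a a' x →
      HasPartialDeriv i b b' x → HasPartialDeriv i (fun y => op (a y) (b y)) (op a' b') x)
    (hf : IsCrOn r U f) (hg : IsCrOn r U g) :
    IsCrOn r U (fun y => op (f y) (g y)) ∧ ∀ l : List (Fin n), (l.length : ℕ∞) ≤ r →
      EqOn (iteratedPartialDeriv l fun y => op (f y) (g y))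
        (fun y => op (iteratedPartialDeriv l f y) (iteratedPartialDeriv l g y)) U := by
  have key : ∀ l : List (Fin n), (l.length : ℕ∞) ≤ r →
      EqOn (iteratedPartialDeriv l fun y => op (f y) (g y))
        (fun y => op (iteratedPartialDeriv l f y) (iteratedPartialDeriv l g y)) U := by
    intro l
    induction l with
    | nil => intro _ x _; rfl
    | cons i l ih =>
      intro hl x hx
      have hl' : (l.length : ℕ∞) ≤ r := le_trans (by exact_mod_cast Nat.le_succ l.length) hl
      exact ((hder i _ _ _ _ x (hf.exists_deriv hl hx) (hg.exists_deriv hl hx)).congr_on hU hx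
        (ih hl')).partialDeriv_eq
  refine ⟨fun l hl => ⟨?_, fun hlt i x hx => ?_⟩, key⟩
  · exact (hop.comp_continuousOn ((hf l hl).1.prodMk (hg l hl).1)).congr (key l hl)
  · obtain ⟨a', ha⟩ := (hf l hl).2 hlt i x hx
    obtain ⟨b', hb⟩ := (hg l hl).2 hlt i x hx
    exact ⟨_, (hder i _ _ _ _ x ha hb).congr_on hU hx (key l hl)⟩

theorem isCrOn_zero [T2Space E] (r : ℕ∞) (U : Set (EuclideanSpace ℝ (Fin n))) :
    IsCrOn r U (fun _ => (0 : E)) := by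
  have h0 : ∀ (i : Fin n) (x : EuclideanSpace ℝ (Fin n)),
      HasPartialDeriv i (fun _ => (0 : E)) 0 x := by
    intro i x
    simp [HasPartialDeriv]
  have key : ∀ l : List (Fin n), iteratedPartialDeriv l (fun _ => (0 : E)) = fun _ => 0 := by
    intro l
    induction l with
    | nil => rfl
    | cons i l ih =>
      funext x
      change partialDeriv i (iteratedPartialDeriv l fun _ => (0 : E)) x = 0
      rw [ih]
      exact (h0 i x).partialDeriv_eq
  intro l _
  rw [key l]
  exact ⟨continuousOn_const, fun _ i x _ => ⟨0, h0 i x⟩⟩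

theorem IsCrOn.add [IsTopologicalAddGroup E] [T2Space E] {r : ℕ∞} {U : Set (EuclideanSpace ℝ (Fin n))} (hU : IsOpen U)
    {f g : EuclideanSpace ℝ (Fin n) → E} (hf : IsCrOn r U f) (hg : IsCrOn r U g) :
    IsCrOn r U (f + g) :=
  (IsCrOn.of_op hU (fun a b => a + b) continuous_add (fun i a b a' b' x ha hb => by
    refine (Tendsto.add ha hb).congr fun t => ?_
    rw [← smul_add, add_sub_add_comm]) hf hg).1

theorem IsCrOn.const_smul [ContinuousSMul ℝ E] [T2Space E] {r : ℕ∞} {U : Set (EuclideanSpace ℝ (Fin n))}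
    (hU : IsOpen U) (c : ℝ) {f : EuclideanSpace ℝ (Fin n) → E} (hf : IsCrOn r U f) :
    IsCrOn r U (c • f) :=
  (IsCrOn.of_op hU (fun a _ => c • a) (continuous_fst.const_smul c)
    (fun i a b a' b' x ha _ => by
      refine (Tendsto.const_smul ha c).congr fun t => ?_
      rw [smul_comm, smul_sub]) hf hf).1

theorem IsCrOn.smul_const [ContinuousSMul ℝ E] [T2Space E] {r : ℕ∞} {U : Set (EuclideanSpace ℝ (Fin n))}
    (hU : IsOpen U) {f : EuclideanSpace ℝ (Fin n) → ℝ} (hf : IsCrOn r U f) (v : E) :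
    IsCrOn r U (fun x => f x • v) :=
  (IsCrOn.of_op hU (fun a _ => a • v) (continuous_fst.smul continuous_const)
    (fun i a b a' b' x ha _ => by
      refine (Tendsto.smul_const ha v).congr fun t => ?_
      rw [smul_assoc, sub_smul]) hf hf).1

end PartialDerivatives

/-! ### The case `r > 0`: `C^r`-functions on an `n`-dimensional `C^r`-manifold -/

section Manifold

variable (r : ℕ∞) (n : ℕ) (M : Type*) (E : Type*) [TopologicalSpace M]
  [ChartedSpace (EuclideanSpace ℝ (Fin n)) M] [AddCommGroup E] [Module ℝ E] [TopologicalSpace E]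
  [IsTopologicalAddGroup E] [ContinuousSMul ℝ E] [T2Space E]

/-- The `C^r`-charts of `M`. -/
abbrev crCharts : Set (OpenPartialHomeomorph M (EuclideanSpace ℝ (Fin n))) :=
  IsManifold.maximalAtlas (modelWithCornersSelf ℝ (EuclideanSpace ℝ (Fin n))) r M

/-- The `C^r`-maps `M → E`: those which are `C^r` in every `C^r`-chart. -/
def crSubmodule : Submodule ℝ (M → E) where
  carrier := {γ | ∀ φ ∈ crCharts r n M, IsCrOn r φ.target (γ ∘ φ.symm)}
  zero_mem' φ _ := isCrOn_zero r φ.target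
  add_mem' ha hb φ hφ := (ha φ hφ).add φ.open_target (hb φ hφ)
  smul_mem' c _ ha φ hφ := (ha φ hφ).const_smul φ.open_target c

/-- The space `C^r(M, E)`, as a type of its own: it does not carry the topology of pointwise
convergence. -/
def CrMap : Type _ := crSubmodule r n M E

instance : AddCommGroup (CrMap r n M E) := inferInstanceAs (AddCommGroup (crSubmodule r n M E))

instance : Module ℝ (CrMap r n M E) := inferInstanceAs (Module ℝ (crSubmodule r n M E))

/-- The underlying function of a `C^r`-map. -/
def crEval : CrMap r n M E →ₗ[ℝ] (M → E) := (crSubmodule r n M E).subtype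

variable {r n M E} in
/-- The iterated partial derivative of a `C^r`-map in a chart, a continuous map on the range of
the chart. -/
def CrMap.chartDeriv (φ : OpenPartialHomeomorph M (EuclideanSpace ℝ (Fin n)))
    (hφ : φ ∈ crCharts r n M) (l : List (Fin n)) (hl : (l.length : ℕ∞) ≤ r)
    (γ : CrMap r n M E) : C(φ.target, E) :=
  ⟨φ.target.domRestrict (iteratedPartialDeriv l (crEval r n M E γ ∘ φ.symm)),
    (γ.2 φ hφ l hl).1.domRestrict⟩

/-- The compact-open `C^r`-topology on `C^r(M, E)`: the initial topology with respect to the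
partial derivatives of order at most `r` in all charts, where the spaces of continuous maps on
the ranges of the charts carry the compact-open topology. -/
instance : TopologicalSpace (CrMap r n M E) :=
  ⨅ (φ : OpenPartialHomeomorph M (EuclideanSpace ℝ (Fin n))) (hφ : φ ∈ crCharts r n M)
    (l : List (Fin n)) (hl : (l.length : ℕ∞) ≤ r),
    TopologicalSpace.induced (CrMap.chartDeriv φ hφ l hl) inferInstance

/-- The space `C^r_c(M, E)`, with the locally convex direct limit topology. -/
abbrev CrTestFunctions : Type _ := TestFunctions (crEval r n M E)

/-- The bilinear map `(γ, v) ↦ γ v` from `C^r(M, ℝ) × E` to `C^r(M, E)`. -/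
def crSMulRight : CrMap r n M ℝ →ₗ[ℝ] E →ₗ[ℝ] CrMap r n M E :=
  LinearMap.mk₂ ℝ
    (fun (γ : crSubmodule r n M ℝ) v => (⟨fun x => γ.1 x • v,
      fun φ hφ => (γ.2 φ hφ).smul_const φ.open_target v⟩ : crSubmodule r n M E))
    (fun a b v => Subtype.ext (funext fun x => add_smul (a.1 x) (b.1 x) v))
    (fun c a v => Subtype.ext (funext fun x => mul_smul c (a.1 x) v))
    (fun a v w => Subtype.ext (funext fun x => smul_add (a.1 x) v w))
    (fun c a v => Subtype.ext (funext fun x => smul_comm (a.1 x) c v))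

/-- The bilinear map `(γ, v) ↦ γ v` from `C^r_c(M, ℝ) × E` to `C^r_c(M, E)`. -/
def crPsi : CrTestFunctions r n M ℝ →ₗ[ℝ] E →ₗ[ℝ] CrTestFunctions r n M E :=
  TestFunctions.smulRight (crEval r n M ℝ) (crEval r n M E) (crSMulRight r n M E)
    (fun _ _ => rfl)

end Manifold

end

noncomputable section

/-! ### Continuous seminorms and bilinear maps on locally convex spaces -/

section Seminorms

/-! A bilinear map between locally convex spaces is continuous iff every continuous seminorm `q` on
the target satisfies `q (β x y) ≤ p₁ x * p₂ y` with continuous seminorms `p₁`, `p₂`. On functions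
supported in a fixed compact set such a bound for `(γ, v) ↦ γ v` is automatic, because `C^r(M) × E →
C^r(M, E)` is continuous. The difficulty is that `p₂` depends on the compact set.

Sufficiency: take a partition of unity `h i` with compact supports. Then `q (γ v) ≤ ∑ i, p₁ i (h i
γ) * p₂ i v`. At most `θ(M)` of the `h i` are nonzero, so the neighbourhood property yields one `p`
with `p₂ i ≤ C i * p`. By local finiteness `∑ i, C i * p₁ i (h i γ)` is a continuous seminorm of
`γ`.

Necessity: given at most `θ(M)` seminorms `p`, attach to them points `x_p` of which each compact set
contains only finitely many. Some continuous seminorm `q` on `C^r_c(M, E)` dominates all `η ↦ p (η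
x_p)`. A product bound for `q`, applied to some `γ` with `γ x_p ≠ 0`, gives `|γ x_p| * p v ≤ p₁ γ *
p₂ v`, so `p₂` dominates every `p`.

Hypocontinuity: a bounded set of test functions lives on a single compact set, where the product
bound applies. For bounded `B ⊆ E` the seminorm `γ ↦ sup_{v ∈ B} q (γ v)` is continuous on each step
of the limit, hence continuous.

The cases `r = 0` and `r > 0` are treated together, for an abstract space `X` of functions with
evaluation `ev`; they meet in `smulRight_hypocontinuous_and_continuous_iff`. -/

theorem exists_continuous_seminorm_ball_subset {E : Type*} [AddCommGroup E] [Module ℝ E]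
    [TopologicalSpace E] [IsTopologicalAddGroup E] [ContinuousSMul ℝ E] [LocallyConvexSpace ℝ E]
    {U : Set E} (hU : U ∈ 𝓝 0) : ∃ p : Seminorm ℝ E, Continuous p ∧ p.ball 0 1 ⊆ U := by
  obtain ⟨s, hs, hsU⟩ := (nhds_hasBasis_absConvex_open ℝ E).mem_iff.1 hU
  let t : AbsConvexOpenSets ℝ E := ⟨s, hs⟩
  refine ⟨gaugeSeminormFamily ℝ E t, with_gaugeSeminormFamily.continuous_seminorm t, ?_⟩
  rw [gaugeSeminormFamily_ball]
  exact hsU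

theorem continuousWithinAt_of_forall_seminorm {A F : Type*} [TopologicalSpace A]
    [AddCommGroup F] [Module ℝ F] [TopologicalSpace F] [IsTopologicalAddGroup F]
    [ContinuousSMul ℝ F] [LocallyConvexSpace ℝ F] {f : A → F} {S : Set A} {a : A}
    (h : ∀ q : Seminorm ℝ F, Continuous q → ∃ g : A → ℝ, ContinuousWithinAt g S a ∧ g a = 0 ∧
      ∀ x ∈ S, q (f x - f a) ≤ g x) : ContinuousWithinAt f S a := by
  refine ((PolynormableSpace.withSeminorms ℝ F).tendsto_nhds f (f a)).2 fun q ε hε => ?_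
  obtain ⟨g, hg, hg0, hle⟩ := h q.1 q.2
  have h1 : ∀ᶠ x in 𝓝[S] a, g x < ε := hg.eventually_lt_const (by rwa [hg0])
  filter_upwards [h1, self_mem_nhdsWithin] with x hx hxS
  exact (hle x hxS).trans_lt hx

variable {E₁ E₂ F : Type*} [AddCommGroup E₁] [Module ℝ E₁] [AddCommGroup E₂] [Module ℝ E₂]
  [AddCommGroup F] [Module ℝ F]

/-- In this splitting the moving point `x` is paired only with an increment, and the other increment
only with the fixed `y₀`. If `x` stays in a bounded set, a uniform estimate handles the first term
and separate continuity the second. -/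
theorem Seminorm.map_bilin_sub_le (q : Seminorm ℝ F) (β : E₁ →ₗ[ℝ] E₂ →ₗ[ℝ] F) (x x₀ : E₁)
    (y y₀ : E₂) : q (β x y - β x₀ y₀) ≤ q (β x (y - y₀)) + q (β (x - x₀) y₀) := by
  have e : β x y - β x₀ y₀ = β x (y - y₀) + β (x - x₀) y₀ := by simp
  rw [e]
  exact map_add_le_add q _ _

variable [TopologicalSpace E₁] [TopologicalSpace E₂] [TopologicalSpace F]

theorem exists_seminorm_bound_of_continuous [IsTopologicalAddGroup E₁] [ContinuousSMul ℝ E₁]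
    [LocallyConvexSpace ℝ E₁] [IsTopologicalAddGroup E₂] [ContinuousSMul ℝ E₂]
    [LocallyConvexSpace ℝ E₂] {β : E₁ →ₗ[ℝ] E₂ →ₗ[ℝ] F}
    (hβ : Continuous fun z : E₁ × E₂ => β z.1 z.2) {q : Seminorm ℝ F} (hq : Continuous q) :
    ∃ (p₁ : Seminorm ℝ E₁) (p₂ : Seminorm ℝ E₂), Continuous p₁ ∧ Continuous p₂ ∧
      ∀ x y, q (β x y) ≤ p₁ x * p₂ y := by
  have h0 : ∀ᶠ z : E₁ × E₂ in 𝓝 0 ×ˢ 𝓝 0, q (β z.1 z.2) < 1 := by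
    rw [← nhds_prod_eq]
    exact (hq.comp hβ).continuousAt.eventually_lt_const (by simp)
  obtain ⟨U, hU, V, hV, hUV⟩ := Filter.mem_prod_iff.1 h0
  obtain ⟨p₁, hp₁, h₁⟩ := exists_continuous_seminorm_ball_subset hU
  obtain ⟨p₂, hp₂, h₂⟩ := exists_continuous_seminorm_ball_subset hV
  refine ⟨p₁, p₂, hp₁, hp₂, fun x y => ?_⟩
  -- The seminorms may vanish at `x` or `y`; the shift by `ε` allows scaling into the unit balls.
  have key : ∀ ε : ℝ, 0 < ε → q (β x y) ≤ (p₁ x + ε) * (p₂ y + ε) := by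
    intro ε hε
    have ha : 0 < p₁ x + ε := add_pos_of_nonneg_of_pos (apply_nonneg _ _) hε
    have hb : 0 < p₂ y + ε := add_pos_of_nonneg_of_pos (apply_nonneg _ _) hε
    have hx : (p₁ x + ε)⁻¹ • x ∈ p₁.ball 0 1 := by
      rw [Seminorm.mem_ball_zero, map_smul_eq_mul, Real.norm_of_nonneg (by positivity),
        inv_mul_lt_iff₀ ha]
      linarith
    have hy : (p₂ y + ε)⁻¹ • y ∈ p₂.ball 0 1 := by
      rw [Seminorm.mem_ball_zero, map_smul_eq_mul, Real.norm_of_nonneg (by positivity),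
        inv_mul_lt_iff₀ hb]
      linarith
    have h : q (β ((p₁ x + ε)⁻¹ • x) ((p₂ y + ε)⁻¹ • y)) < 1 := hUV (mk_mem_prod (h₁ hx) (h₂ hy))
    rw [LinearMap.map_smul₂, map_smul (β x), map_smul_eq_mul, map_smul_eq_mul,
      Real.norm_of_nonneg (by positivity), Real.norm_of_nonneg (by positivity),
      inv_mul_lt_iff₀ ha, inv_mul_lt_iff₀ hb] at h
    linarith
  have hlim : Tendsto (fun ε : ℝ => (p₁ x + ε) * (p₂ y + ε)) (𝓝[>] 0) (𝓝 (p₁ x * p₂ y)) := by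
    have hc : Continuous fun ε : ℝ => (p₁ x + ε) * (p₂ y + ε) := by fun_prop
    simpa using (hc.tendsto 0).mono_left nhdsWithin_le_nhds
  exact ge_of_tendsto hlim (eventually_mem_nhdsWithin.mono fun ε hε => key ε hε)

theorem continuous_of_seminorm_bound [IsTopologicalAddGroup E₁] [IsTopologicalAddGroup E₂]
    [IsTopologicalAddGroup F] [ContinuousSMul ℝ F]
    [LocallyConvexSpace ℝ F] {β : E₁ →ₗ[ℝ] E₂ →ₗ[ℝ] F}
    (h : ∀ q : Seminorm ℝ F, Continuous q → ∃ (p₁ : Seminorm ℝ E₁) (p₂ : Seminorm ℝ E₂),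
      Continuous p₁ ∧ Continuous p₂ ∧ ∀ x y, q (β x y) ≤ p₁ x * p₂ y) :
    Continuous fun z : E₁ × E₂ => β z.1 z.2 := by
  rw [← continuousOn_univ]
  refine fun z _ => continuousWithinAt_of_forall_seminorm fun q hq => ?_
  obtain ⟨p₁, p₂, hp₁, hp₂, hle⟩ := h q hq
  refine ⟨fun w => p₁ w.1 * p₂ (w.2 - z.2) + p₁ (w.1 - z.1) * p₂ z.2, ?_, by simp,
    fun w _ => (q.map_bilin_sub_le β _ _ _ _).trans (add_le_add (hle _ _) (hle _ _))⟩
  have h₁ : Continuous fun w : E₁ × E₂ => p₁ w.1 := hp₁.comp continuous_fst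
  have h₂ : Continuous fun w : E₁ × E₂ => p₂ (w.2 - z.2) := hp₂.comp (by fun_prop)
  have h₃ : Continuous fun w : E₁ × E₂ => p₁ (w.1 - z.1) := hp₁.comp (by fun_prop)
  exact ((h₁.mul h₂).add (h₃.mul continuous_const)).continuousWithinAt

end Seminorms

/-! ### Normability and the neighbourhood property -/

section Normable

variable {E : Type u} [AddCommGroup E] [Module ℝ E] [TopologicalSpace E]

theorem IsNormable.hasNeighbourhoodProperty (h : IsNormable E) (θ : Cardinal.{v}) :
    HasNeighbourhoodProperty θ E := by
  obtain ⟨q, -, hq⟩ := h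
  refine fun P hP _ => ⟨q, hq.continuous_seminorm (), fun p hp => ?_⟩
  obtain ⟨s, C, hC, hle⟩ := Seminorm.bound_of_continuous hq p (hP p hp)
  refine ⟨C, by positivity, fun x => (hle x).trans ?_⟩
  have hs : s.sup (fun _ : Unit => q) ≤ q := Finset.sup_le fun _ _ => le_rfl
  exact mul_le_mul_of_nonneg_left (hs x) C.2

/-- A countable base at `0` needs only countably many seminorms. A common upper bound `q` of these
defines the topology by itself, and it is a norm since `E` is Hausdorff. -/
theorem HasNeighbourhoodProperty.isNormable [IsTopologicalAddGroup E]
    [ContinuousSMul ℝ E] [LocallyConvexSpace ℝ E] [T2Space E] [FirstCountableTopology E]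
    {θ : Cardinal.{v}} (hθ : Cardinal.aleph0 ≤ θ)
    (h : HasNeighbourhoodProperty θ E) : IsNormable E := by
  obtain ⟨U, hU⟩ := (𝓝 (0 : E)).exists_antitone_basis
  choose p hp hpU using fun n => exists_continuous_seminorm_ball_subset (hU.mem n)
  have hcard : Cardinal.lift.{v} (Cardinal.mk (range p)) ≤ Cardinal.lift.{u} θ := by
    refine le_trans (Cardinal.lift_le.2 (Cardinal.mk_le_aleph0_iff.2 (countable_range p))) ?_
    simpa using hθ
  obtain ⟨q, hq, hdom⟩ := h (range p) (by rintro _ ⟨n, rfl⟩; exact hp n) hcard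
  have hws : WithSeminorms fun _ : Unit => q := by
    rw [SeminormFamily.withSeminorms_iff_nhds_eq_iInf, iInf_const]
    refine le_antisymm (hq.tendsto' 0 0 (map_zero q)).le_comap fun W hW => ?_
    obtain ⟨n, hn⟩ := hU.mem_iff.1 hW
    obtain ⟨C, hC, hle⟩ := hdom (p n) (mem_range_self n)
    refine ⟨Iio C⁻¹, Iio_mem_nhds (inv_pos.2 hC), fun x hx => hn (hpU n ?_)⟩
    rw [Seminorm.mem_ball_zero]
    have hx' : q x < C⁻¹ := hx
    calc p n x ≤ C * q x := hle x
      _ < C * C⁻¹ := by gcongr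
      _ = 1 := mul_inv_cancel₀ hC.ne'
  refine ⟨q, fun x hx => ?_, hws⟩
  by_contra hne
  obtain ⟨i, hi⟩ := hws.separating_of_T1 x hne
  exact hi hx

end Normable

/-! ### The compact covering number and locally finite families -/

section CompactCovering

variable {M : Type v} [TopologicalSpace M]

/-- The infimum is attained because cardinals are well-ordered; the cover by singletons shows that
the set is nonempty. -/
theorem exists_compact_cover (M : Type v) [TopologicalSpace M] :
    ∃ S : Set (Set M), (∀ K ∈ S, IsCompact K) ∧ ⋃₀ S = univ ∧
      Cardinal.mk S = compactCoveringNumber M := by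
  refine csInf_mem (s := {κ : Cardinal.{v} | ∃ S : Set (Set M), (∀ K ∈ S, IsCompact K) ∧
    ⋃₀ S = univ ∧ Cardinal.mk S = κ}) ⟨_, range singleton, ?_, ?_, rfl⟩
  · rintro _ ⟨x, rfl⟩
    exact isCompact_singleton
  · rw [sUnion_range]
    exact iUnion_of_singleton M

theorem aleph0_le_compactCoveringNumber [NoncompactSpace M] :
    Cardinal.aleph0 ≤ compactCoveringNumber M := by
  obtain ⟨S, hS, hcov, hcard⟩ := exists_compact_cover M
  by_contra! h
  rw [← hcard, Cardinal.lt_aleph0_iff_set_finite] at h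
  exact noncompact_univ M (hcov ▸ h.isCompact_sUnion hS)

variable {ι : Type v} {V : ι → Set M}

/-- Sending `i` to a member of a minimal compact cover that meets `V i` is a map with finite fibres,
and `θ * ℵ₀ = θ` for infinite `θ`. -/
theorem LocallyFinite.mk_le_compactCoveringNumber [NoncompactSpace M] (hV : LocallyFinite V)
    (hne : ∀ i, (V i).Nonempty) : Cardinal.mk ι ≤ compactCoveringNumber M := by
  obtain ⟨S, hS, hcov, hcard⟩ := exists_compact_cover M
  have hmeet : ∀ i, ∃ K : S, (V i ∩ K).Nonempty := fun i => by
    obtain ⟨x, hx⟩ := hne i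
    obtain ⟨K, hK, hxK⟩ := mem_sUnion.1 (hcov ▸ mem_univ x)
    exact ⟨⟨K, hK⟩, x, hx, hxK⟩
  choose f hf using hmeet
  have hfib : ∀ K : S, Cardinal.mk (f ⁻¹' {K}) ≤ Cardinal.aleph0 := fun K => by
    refine Cardinal.mk_le_aleph0_iff.2 (Finite.countable ?_)
    refine (hV.finite_nonempty_inter_compact (hS K K.2)).subset fun i hi => ?_
    have : f i = K := hi
    exact this ▸ hf i
  calc Cardinal.mk ι ≤ Cardinal.mk S * Cardinal.aleph0 :=
        Cardinal.mk_le_mk_mul_of_mk_preimage_le f hfib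
    _ = compactCoveringNumber M := by
        rw [hcard, Cardinal.mul_aleph0_eq aleph0_le_compactCoveringNumber]

/-- Together with the preceding bound: in a noncompact space, a locally finite cover by nonempty
relatively compact sets has exactly `θ(M)` indices. -/
theorem compactCoveringNumber_le_mk (hV : ∀ i, IsCompact (closure (V i)))
    (hcov : ⋃ i, V i = univ) : compactCoveringNumber M ≤ Cardinal.mk ι := by
  refine le_trans (csInf_le' ⟨range fun i => closure (V i), ?_, ?_, rfl⟩) Cardinal.mk_range_le
  · rintro _ ⟨i, rfl⟩
    exact hV i
  · rw [sUnion_range]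
    exact univ_subset_iff.1 (hcov ▸ iUnion_mono fun i => subset_closure)

end CompactCovering

/-! ### Continuous seminorms on spaces of compactly supported functions -/

/-- The topology defined by `q` alone is one of the locally convex topologies whose infimum is the
limit topology. -/
theorem lcLimitTopology_le_of_withSeminorms {ι V : Type*} {W : ι → Type*}
    [∀ i, AddCommGroup (W i)] [∀ i, Module ℝ (W i)] [∀ i, TopologicalSpace (W i)]
    [∀ i, IsTopologicalAddGroup (W i)] [AddCommGroup V] [Module ℝ V] [t : TopologicalSpace V]
    {f : ∀ i, W i →ₗ[ℝ] V} {q : Seminorm ℝ V} (hq : WithSeminorms fun _ : Unit => q)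
    (h : ∀ i, Continuous (q.comp (f i))) : lcLimitTopology f ≤ t :=
  sInf_le ⟨fun i => hq.continuous_of_continuous_comp (f i) fun _ => h i,
    hq.topologicalAddGroup, hq.continuousSMul, hq.toLocallyConvexSpace⟩

namespace TestFunctions

section

variable {M E X : Type*} [TopologicalSpace M] [AddCommGroup E] [Module ℝ E]
  [AddCommGroup X] [Module ℝ X]

/-- The inclusion of the compactly supported functions into the space of all functions. -/
def toAmbient (ev : X →ₗ[ℝ] (M → E)) : TestFunctions ev →ₗ[ℝ] X :=
  (functionsWithCompactSupport ev).subtype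

theorem hasCompactSupport {ev : X →ₗ[ℝ] (M → E)} (γ : TestFunctions ev) :
    HasCompactSupport (ev (toAmbient ev γ)) := γ.2

@[simp]
theorem toAmbient_incl {ev : X →ₗ[ℝ] (M → E)} (K : TopologicalSpace.Compacts M)
    (γ : supportedIn ev K) : toAmbient ev (incl ev K γ) = γ := rfl

theorem toAmbient_injective {ev : X →ₗ[ℝ] (M → E)} : Function.Injective (toAmbient ev) :=
  Subtype.val_injective

theorem exists_incl_eq_of_tsupport_subset {ev : X →ₗ[ℝ] (M → E)} {K : TopologicalSpace.Compacts M}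
    {γ : TestFunctions ev} (h : tsupport (ev (toAmbient ev γ)) ⊆ K) :
    ∃ γ' : supportedIn ev K, incl ev K γ' = γ :=
  ⟨⟨γ.1, h⟩, rfl⟩

theorem exists_incl_eq {ev : X →ₗ[ℝ] (M → E)} (γ : TestFunctions ev) :
    ∃ (K : TopologicalSpace.Compacts M) (γ' : supportedIn ev K), incl ev K γ' = γ :=
  ⟨⟨_, hasCompactSupport γ⟩, ⟨γ.1, Subset.rfl⟩, rfl⟩

variable [TopologicalSpace X] (ev : X →ₗ[ℝ] (M → E))

/-- The defining properties of the competing topologies survive infima, so the limit topology is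
itself one of them. -/
instance : IsTopologicalAddGroup (TestFunctions ev) := topologicalAddGroup_sInf fun _ ht => ht.2.1

instance : ContinuousSMul ℝ (TestFunctions ev) := continuousSMul_sInf fun _ ht => ht.2.2.1

instance : LocallyConvexSpace ℝ (TestFunctions ev) := .sInf fun _ ht => ht.2.2.2

theorem continuous_incl (K : TopologicalSpace.Compacts M) : Continuous (incl ev K) :=
  continuous_sInf_rng.2 fun _ ht => ht.1 K

variable {ev}

theorem continuous_seminorm [IsTopologicalAddGroup X] {q : Seminorm ℝ (TestFunctions ev)}
    (h : ∀ K, Continuous (q.comp (incl ev K))) : Continuous q := by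
  let p : SeminormFamily ℝ (TestFunctions ev) Unit := fun _ => q
  let t : TopologicalSpace (TestFunctions ev) := p.moduleFilterBasis.topology
  have ht : @WithSeminorms ℝ (TestFunctions ev) Unit _ _ _ p t := ⟨rfl⟩
  exact continuous_le_dom (lcLimitTopology_le_of_withSeminorms (t := t) ht fun K => h K)
    (@WithSeminorms.continuous_seminorm _ _ _ _ _ _ t p ht ())

theorem continuous_linearMap [IsTopologicalAddGroup X] {F : Type*} [AddCommGroup F] [Module ℝ F]
    [TopologicalSpace F] [IsTopologicalAddGroup F] [ContinuousSMul ℝ F] [LocallyConvexSpace ℝ F]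
    {f : TestFunctions ev →ₗ[ℝ] F} (h : ∀ K, Continuous (f ∘ₗ incl ev K)) : Continuous f :=
  (PolynormableSpace.withSeminorms ℝ F).continuous_of_continuous_comp f fun p =>
    continuous_seminorm fun K => p.2.comp (h K)

theorem continuous_toAmbient [IsTopologicalAddGroup X] [ContinuousSMul ℝ X]
    [LocallyConvexSpace ℝ X] : Continuous (toAmbient ev) :=
  continuous_linearMap fun _ => continuous_subtype_val

/-- A family of continuous seminorms, of which only finitely many do not vanish on the functions
supported in a given compact set, is summable to a continuous seminorm. -/
theorem exists_continuous_seminorm_sum_le [IsTopologicalAddGroup X] {J : Type*}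
    {s : J → Seminorm ℝ (TestFunctions ev)} (hs : ∀ j, Continuous (s j))
    (hfin : ∀ K, {j | ∃ γ : supportedIn ev K, s j (incl ev K γ) ≠ 0}.Finite) :
    ∃ q : Seminorm ℝ (TestFunctions ev), Continuous q ∧
      ∀ γ (T : Finset J), ∑ j ∈ T, s j γ ≤ q γ := by
  have hsupp : ∀ γ, (Function.support fun j => s j γ).Finite := fun γ => by
    obtain ⟨K, γ', rfl⟩ := exists_incl_eq γ
    exact (hfin K).subset fun j hj => ⟨γ', hj⟩
  classical
  let q : Seminorm ℝ (TestFunctions ev) := Seminorm.of (fun γ => ∑ᶠ j, s j γ)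
    (fun a b => by
      -- Over one finite set containing all three supports, subadditivity holds term by term.
      have h : ∀ T : Finset J, (hsupp a).toFinset ⊆ T → (hsupp b).toFinset ⊆ T →
          (hsupp (a + b)).toFinset ⊆ T → ∑ᶠ j, s j (a + b) ≤ ∑ᶠ j, s j a + ∑ᶠ j, s j b := by
        intro T ha hb hab
        rw [Finite.toFinset_subset] at ha hb hab
        rw [finsum_eq_sum_of_support_subset _ ha, finsum_eq_sum_of_support_subset _ hb,
          finsum_eq_sum_of_support_subset _ hab, ← Finset.sum_add_distrib]
        exact Finset.sum_le_sum fun j _ => map_add_le_add (s j) a b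
      exact h ((hsupp a).toFinset ∪ (hsupp b).toFinset ∪ (hsupp (a + b)).toFinset)
        (Finset.subset_union_left.trans Finset.subset_union_left)
        (Finset.subset_union_right.trans Finset.subset_union_left) Finset.subset_union_right)
    (fun c a => by simp only [map_smul_eq_mul, ← smul_eq_mul, smul_finsum])
  refine ⟨q, continuous_seminorm fun K => ?_, fun γ T => ?_⟩
  -- On functions supported in `K` the index set of the sum is a fixed finite set, so continuity is
  -- that of a finite sum.
  · have hq : ∀ γ : supportedIn ev K,
        q (incl ev K γ) = ∑ j ∈ (hfin K).toFinset, s j (incl ev K γ) := fun γ =>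
      finsum_eq_sum_of_support_subset _ fun j hj => by simpa using ⟨γ, γ.2, hj⟩
    change Continuous fun γ => q (incl ev K γ)
    simp only [hq]
    exact continuous_finsetSum _ fun j _ => (hs j).comp (continuous_incl ev K)
  · have hq : q γ = ∑ j ∈ T ∪ (hsupp γ).toFinset, s j γ :=
      finsum_eq_sum_of_support_subset _ fun j hj => by simp [Function.mem_support.1 hj]
    rw [hq]
    exact Finset.sum_le_sum_of_subset_of_nonneg Finset.subset_union_left
      fun j _ _ => apply_nonneg _ _

/-- For seminorms that only depend on the value at a point of a family of points of which every
compact set contains only finitely many, there is a continuous upper bound. -/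
theorem exists_continuous_seminorm_eval_le [IsTopologicalAddGroup X] [ContinuousSMul ℝ X]
    [LocallyConvexSpace ℝ X] [TopologicalSpace E] (hev : ∀ x, Continuous fun γ => ev γ x)
    {J : Type*} {x : J → M} (hx : ∀ K, IsCompact K → {j | x j ∈ K}.Finite)
    {p : J → Seminorm ℝ E} (hp : ∀ j, Continuous (p j)) :
    ∃ q : Seminorm ℝ (TestFunctions ev), Continuous q ∧
      ∀ γ j, p j (ev (toAmbient ev γ) (x j)) ≤ q γ := by
  let s : J → Seminorm ℝ (TestFunctions ev) := fun j =>
    (p j).comp (LinearMap.proj (x j) ∘ₗ ev ∘ₗ toAmbient ev)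
  obtain ⟨q, hq, hle⟩ := exists_continuous_seminorm_sum_le (s := s)
    (fun j => (hp j).comp ((hev (x j)).comp continuous_toAmbient)) fun K => by
      refine (hx K K.isCompact).subset fun j hj => ?_
      obtain ⟨γ, hγ⟩ := hj
      refine γ.2 (subset_tsupport _ fun h0 => hγ ?_)
      change p j (ev γ (x j)) = 0
      rw [h0, map_zero]
  exact ⟨q, hq, fun γ j => by
    have h := hle γ {j}
    rwa [Finset.sum_singleton] at h⟩

end

end TestFunctions

/-! ### Bilinear maps of the form `(γ, v) ↦ γ v` on compactly supported functions -/

namespace TestFunctions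

/-- If members of `B` were nonzero somewhere on infinitely many of the `V i`, one could pick `γ n ∈
B` and points `x n` in different `V i` with `γ n (x n) ≠ 0`. Each compact set contains only finitely
many `x n`, so a continuous seminorm may weight these points arbitrarily and be unbounded on `B`. -/
theorem exists_compacts_of_isVonNBounded {M X : Type*} [TopologicalSpace M] [AddCommGroup X]
    [Module ℝ X] [TopologicalSpace X] [IsTopologicalAddGroup X] [ContinuousSMul ℝ X]
    [LocallyConvexSpace ℝ X] {ev : X →ₗ[ℝ] (M → ℝ)} (hev : ∀ x, Continuous fun γ => ev γ x)
    {ι : Type*} {V : ι → Set M} (hV : LocallyFinite V) (hcov : ⋃ i, V i = univ)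
    (hc : ∀ i, IsCompact (closure (V i))) {B : Set (TestFunctions ev)}
    (hB : Bornology.IsVonNBounded ℝ B) :
    ∃ K : TopologicalSpace.Compacts M, ∀ γ ∈ B, tsupport (ev (toAmbient ev γ)) ⊆ K := by
  let J : Set ι := {i | ∃ γ ∈ B, ∃ x ∈ V i, ev (toAmbient ev γ) x ≠ 0}
  by_cases hJ : J.Finite
  · refine ⟨⟨⋃ i ∈ J, closure (V i), hJ.isCompact_biUnion fun i _ => hc i⟩, fun γ hγ => ?_⟩
    refine closure_minimal (fun x hx => ?_) (hJ.isClosed_biUnion fun i _ => isClosed_closure)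
    obtain ⟨i, hi⟩ := mem_iUnion.1 (hcov ▸ mem_univ x)
    exact mem_biUnion (show i ∈ J from ⟨γ, hγ, x, hi, hx⟩) (subset_closure hi)
  · have hinf : J.Infinite := hJ
    let e : ℕ ↪ J := hinf.natEmbedding J
    choose γ hγ x hx hne using fun n => (e n).2
    have hfin : ∀ K, IsCompact K → {n | x n ∈ K}.Finite := fun K hK => by
      refine ((hV.finite_nonempty_inter_compact hK).preimage
        (Subtype.val_injective.comp e.injective).injOn).subset fun n hn => ?_
      exact ⟨x n, hx n, hn⟩
    -- The weight is chosen so that `p n` takes the value `n` at `γ n (x n)`.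
    let p : ℕ → Seminorm ℝ ℝ := fun n =>
      (n * ‖ev (toAmbient ev (γ n)) (x n)‖₊⁻¹ : NNReal) • normSeminorm ℝ ℝ
    obtain ⟨q, hq, hle⟩ := exists_continuous_seminorm_eval_le hev hfin (p := p)
      fun n => continuous_norm.const_smul _
    obtain ⟨r, -, hr⟩ := (PolynormableSpace.withSeminorms ℝ _).isVonNBounded_iff_seminorm_bounded.1
      hB ⟨q, hq⟩
    obtain ⟨n, hn⟩ := exists_nat_gt r
    have h1 : p n (ev (toAmbient ev (γ n)) (x n)) = n := by
      have h0 : ‖ev (toAmbient ev (γ n)) (x n)‖ ≠ 0 := norm_ne_zero_iff.2 (hne n)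
      change ((n * ‖ev (toAmbient ev (γ n)) (x n)‖₊⁻¹ : NNReal) : ℝ) *
        ‖ev (toAmbient ev (γ n)) (x n)‖ = n
      push_cast
      rw [mul_assoc, inv_mul_cancel₀ h0, mul_one]
    have h2 := hle (γ n) n
    have h3 : q (γ n) < r := hr _ (hγ n)
    linarith

section SMulRight

variable {M : Type v} {E : Type u} {X Y : Type*} [TopologicalSpace M]
  [AddCommGroup E] [Module ℝ E] [TopologicalSpace E]
  [AddCommGroup X] [Module ℝ X] [TopologicalSpace X]
  [AddCommGroup Y] [Module ℝ Y] [TopologicalSpace Y]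
  {ev₁ : X →ₗ[ℝ] (M → ℝ)} {ev₂ : Y →ₗ[ℝ] (M → E)} {m : X →ₗ[ℝ] E →ₗ[ℝ] Y}
  {hm : ∀ γ v, ev₂ (m γ v) = fun x => ev₁ γ x • v}

/-- Since `γ v` vanishes wherever `γ` does, for fixed `K` the map factors through the functions
supported in `K`, where the topology is the one induced by `Y`. -/
theorem continuous_smulRight_incl (hmc : Continuous fun z : X × E => m z.1 z.2)
    (K : TopologicalSpace.Compacts M) :
    Continuous fun z : supportedIn ev₁ K × E => smulRight ev₁ ev₂ m hm (incl ev₁ K z.1) z.2 := by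
  have hK : ∀ z : supportedIn ev₁ K × E, m z.1 z.2 ∈ supportedIn ev₂ K := fun z => by
    refine Subset.trans (closure_mono fun x hx => ?_) z.1.2
    rw [hm] at hx
    exact fun h0 => hx (by simp only [h0, zero_smul])
  exact (continuous_incl ev₂ K).comp
    ((hmc.comp (continuous_subtype_val.prodMap continuous_id)).subtype_mk hK)

theorem continuous_smulRight_left [IsTopologicalAddGroup X]
    (hmc : Continuous fun z : X × E => m z.1 z.2) (v : E) :
    Continuous fun γ => smulRight ev₁ ev₂ m hm γ v :=
  continuous_linearMap (f := (smulRight ev₁ ev₂ m hm).flip v) fun K =>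
    (continuous_smulRight_incl (hm := hm) hmc K).comp (Continuous.prodMk_left v)

theorem continuous_smulRight_right (hmc : Continuous fun z : X × E => m z.1 z.2)
    (γ : TestFunctions ev₁) : Continuous fun v => smulRight ev₁ ev₂ m hm γ v := by
  obtain ⟨K, γ', rfl⟩ := exists_incl_eq γ
  exact (continuous_smulRight_incl (hm := hm) hmc _).comp (Continuous.prodMk_right γ')

variable [IsTopologicalAddGroup E] [ContinuousSMul ℝ E] [LocallyConvexSpace ℝ E]

/-- If the bilinear map is continuous, then `E` has the neighbourhood property. -/
theorem hasNeighbourhoodProperty_of_continuous_smulRight [IsTopologicalAddGroup Y]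
    [ContinuousSMul ℝ Y] [LocallyConvexSpace ℝ Y] (hev : ∀ x, Continuous fun η => ev₂ η x)
    {ι : Type v} {V : ι → Set M} (hV : LocallyFinite V) (hcov : ⋃ i, V i = univ)
    (hc : ∀ i, IsCompact (closure (V i)))
    (hne : ∀ x, ∃ γ : TestFunctions ev₁, ev₁ (toAmbient ev₁ γ) x ≠ 0)
    (hcont : Continuous fun z : TestFunctions ev₁ × E => smulRight ev₁ ev₂ m hm z.1 z.2) :
    HasNeighbourhoodProperty (compactCoveringNumber M) E := by
  intro P hP hcard
  -- A point is needed in each `V i`. The nonempty ones still cover `M`, so there are at least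
  -- `θ(M)` of them and `P` embeds into `J`.
  let J : Set ι := {i | (V i).Nonempty}
  have hJcov : ⋃ i : J, V i = univ := by
    refine univ_subset_iff.1 fun x _ => ?_
    obtain ⟨i, hi⟩ := mem_iUnion.1 (hcov ▸ mem_univ x)
    exact mem_iUnion.2 ⟨⟨i, x, hi⟩, hi⟩
  have hJ : compactCoveringNumber M ≤ Cardinal.mk J :=
    compactCoveringNumber_le_mk (fun i : J => hc i) hJcov
  obtain ⟨e⟩ := Cardinal.lift_mk_le'.1 (hcard.trans (Cardinal.lift_le.2 hJ))
  choose x hx using fun i : J => i.2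
  have hfin : ∀ K, IsCompact K → {p : P | x (e p) ∈ K}.Finite := fun K hK =>
    ((hV.finite_nonempty_inter_compact hK).preimage
      (Subtype.val_injective.comp e.injective).injOn).subset fun p hp => ⟨x (e p), hx _, hp⟩
  obtain ⟨q, hq, hle⟩ := exists_continuous_seminorm_eval_le hev hfin (p := Subtype.val)
    fun p => hP p p.2
  obtain ⟨p₁, p₂, -, hp₂, hb⟩ := exists_seminorm_bound_of_continuous hcont hq
  refine ⟨p₂, hp₂, fun p hp => ?_⟩
  obtain ⟨γ, hγ⟩ := hne (x (e ⟨p, hp⟩))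
  set c := ev₁ (toAmbient ev₁ γ) (x (e ⟨p, hp⟩)) with hcdef
  have hc0 : 0 < ‖c‖ := norm_pos_iff.2 hγ
  -- Both `γ` and this constant may depend on `p`; only `p₂` has to be common. The summand `1` keeps
  -- the constant positive if `p₁ γ = 0`.
  refine ⟨‖c‖⁻¹ * (p₁ γ + 1), by positivity, fun v => ?_⟩
  have h1 : ‖c‖ * p v ≤ p₁ γ * p₂ v := by
    refine le_trans ?_ ((hle _ ⟨p, hp⟩).trans (hb γ v))
    have h2 : ev₂ (toAmbient ev₂ (smulRight ev₁ ev₂ m hm γ v)) (x (e ⟨p, hp⟩)) = c • v :=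
      congrFun (hm (toAmbient ev₁ γ) v) _
    rw [h2, map_smul_eq_mul]
  have h3 : 0 ≤ p₂ v := apply_nonneg _ _
  rw [mul_assoc, le_inv_mul_iff₀ hc0]
  linarith

variable [IsTopologicalAddGroup X] [ContinuousSMul ℝ X] [LocallyConvexSpace ℝ X]

/-- The seminorm `p₁` is taken on all of `X`, not just on the functions supported in `K`, so that
its composite with `toAmbient` is a continuous seminorm on the test functions. -/
theorem exists_seminorm_bound (hmc : Continuous fun z : X × E => m z.1 z.2)
    (K : TopologicalSpace.Compacts M) {q : Seminorm ℝ (TestFunctions ev₂)} (hq : Continuous q) :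
    ∃ (p₁ : Seminorm ℝ X) (p₂ : Seminorm ℝ E), Continuous p₁ ∧ Continuous p₂ ∧
      ∀ (γ : supportedIn ev₁ K) v,
        q (smulRight ev₁ ev₂ m hm (incl ev₁ K γ) v) ≤ p₁ γ * p₂ v := by
  obtain ⟨p, p₂, hp, hp₂, hle⟩ := exists_seminorm_bound_of_continuous
    (β := smulRight ev₁ ev₂ m hm ∘ₗ incl ev₁ K) (continuous_smulRight_incl (hm := hm) hmc K) hq
  obtain ⟨p₁, hp₁, hle₁⟩ := Seminorm.exists_le_comp_of_isInducing hp
    (f := (supportedIn ev₁ K).subtype) IsInducing.subtypeVal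
  exact ⟨p₁, p₂, hp₁, hp₂, fun γ v => (hle γ v).trans
    (mul_le_mul_of_nonneg_right (hle₁ γ) (apply_nonneg _ _))⟩

theorem continuousOn_smulRight_of_isVonNBounded_left
    (hmc : Continuous fun z : X × E => m z.1 z.2) (hev : ∀ x, Continuous fun γ => ev₁ γ x)
    {ι : Type*} {V : ι → Set M} (hV : LocallyFinite V) (hcov : ⋃ i, V i = univ)
    (hc : ∀ i, IsCompact (closure (V i))) {B : Set (TestFunctions ev₁)}
    (hB : Bornology.IsVonNBounded ℝ B) :
    ContinuousOn (fun z : TestFunctions ev₁ × E => smulRight ev₁ ev₂ m hm z.1 z.2)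
      (B ×ˢ (univ : Set E)) := by
  obtain ⟨K, hK⟩ := exists_compacts_of_isVonNBounded hev hV hcov hc hB
  refine fun z _ => continuousWithinAt_of_forall_seminorm fun q hq => ?_
  obtain ⟨p₁, p₂, hp₁, hp₂, hle⟩ := exists_seminorm_bound (hm := hm) hmc K hq
  obtain ⟨r, -, hr⟩ := (PolynormableSpace.withSeminorms ℝ _).isVonNBounded_iff_seminorm_bounded.1
    hB ⟨p₁.comp (toAmbient ev₁), hp₁.comp continuous_toAmbient⟩
  refine ⟨fun w => r * p₂ (w.2 - z.2) + q (smulRight ev₁ ev₂ m hm (w.1 - z.1) z.2), ?_, by simp,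
    fun w hw => (q.map_bilin_sub_le _ _ _ _ _).trans (add_le_add_left ?_ _)⟩
  · have h₂ : Continuous fun w : TestFunctions ev₁ × E => p₂ (w.2 - z.2) := hp₂.comp (by fun_prop)
    have h₃ : Continuous fun w : TestFunctions ev₁ × E =>
        q (smulRight ev₁ ev₂ m hm (w.1 - z.1) z.2) :=
      hq.comp ((continuous_smulRight_left hmc z.2).comp (continuous_fst.sub continuous_const))
    exact ((continuous_const.mul h₂).add h₃).continuousWithinAt
  · obtain ⟨γ, hγ⟩ := exists_incl_eq_of_tsupport_subset (hK w.1 hw.1)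
    have h₁ : p₁ (toAmbient ev₁ w.1) < r := hr _ hw.1
    rw [← hγ] at h₁ ⊢
    exact (hle γ _).trans (mul_le_mul_of_nonneg_right h₁.le (apply_nonneg _ _))

theorem continuousOn_smulRight_of_isVonNBounded_right
    (hmc : Continuous fun z : X × E => m z.1 z.2) {B : Set E}
    (hB : Bornology.IsVonNBounded ℝ B) :
    ContinuousOn (fun z : TestFunctions ev₁ × E => smulRight ev₁ ev₂ m hm z.1 z.2)
      ((univ : Set (TestFunctions ev₁)) ×ˢ B) := by
  refine fun z hz => continuousWithinAt_of_forall_seminorm fun q hq => ?_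
  have hK : ∀ K : TopologicalSpace.Compacts M, ∃ p : Seminorm ℝ X, Continuous p ∧
      ∀ γ : supportedIn ev₁ K, ∀ v ∈ B, q (smulRight ev₁ ev₂ m hm (incl ev₁ K γ) v) ≤ p γ := by
    intro K
    obtain ⟨p₁, p₂, hp₁, hp₂, hle⟩ := exists_seminorm_bound (hm := hm) hmc K hq
    obtain ⟨r, hr0, hr⟩ :=
      (PolynormableSpace.withSeminorms ℝ _).isVonNBounded_iff_seminorm_bounded.1 hB ⟨p₂, hp₂⟩
    refine ⟨r.toNNReal • p₁, hp₁.const_smul _, fun γ v hv => (hle γ v).trans ?_⟩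
    change _ ≤ (r.toNNReal : ℝ) * p₁ γ
    rw [Real.coe_toNNReal _ hr0.le, mul_comm]
    exact mul_le_mul_of_nonneg_right (hr v hv).le (apply_nonneg _ _)
  choose p hp hle using hK
  let s : B → Seminorm ℝ (TestFunctions ev₁) := fun v => q.comp ((smulRight ev₁ ev₂ m hm).flip v)
  have hbdd : BddAbove (range s) := by
    rw [Seminorm.bddAbove_range_iff]
    intro γ
    obtain ⟨K, γ', rfl⟩ := exists_incl_eq γ
    exact ⟨p _ γ', by rintro _ ⟨v, rfl⟩; exact hle _ γ' v v.2⟩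
  -- `S γ` is the supremum of `q (γ v)` over `v ∈ B`. On each compact set it is bounded by the
  -- continuous seminorm `p K`, which is all that the limit topology requires.
  let S : Seminorm ℝ (TestFunctions ev₁) := ⨆ v, s v
  have hs : Continuous S := continuous_seminorm fun K => by
    refine Seminorm.continuous_of_le (q := (p K).comp (supportedIn ev₁ K).subtype)
      ((hp K).comp continuous_subtype_val) fun γ => ?_
    change (⨆ v, s v) (incl ev₁ K γ) ≤ p K γ
    rw [Seminorm.iSup_apply hbdd]
    exact Real.iSup_le (fun v => hle K γ v v.2) (apply_nonneg _ _)
  have hsle : ∀ γ, ∀ v ∈ B, q (smulRight ev₁ ev₂ m hm γ v) ≤ S γ := fun γ v hv => by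
    change _ ≤ (⨆ v, s v) γ
    rw [Seminorm.iSup_apply hbdd]
    exact le_ciSup (f := fun v => s v γ) (Seminorm.bddAbove_range_iff.1 hbdd γ) ⟨v, hv⟩
  -- The flipped map is used so that the moving vector `w.2 ∈ B` is paired with the increment of
  -- `γ`.
  refine ⟨fun w => S (w.1 - z.1) + q (smulRight ev₁ ev₂ m hm z.1 (w.2 - z.2)), ?_, by simp,
    fun w hw => (q.map_bilin_sub_le (smulRight ev₁ ev₂ m hm).flip _ _ _ _).trans
      (add_le_add_left (hsle _ _ hw.2) _)⟩
  have h₂ : Continuous fun w : TestFunctions ev₁ × E => S (w.1 - z.1) :=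
    hs.comp (continuous_fst.sub continuous_const)
  have h₃ : Continuous fun w : TestFunctions ev₁ × E =>
      q (smulRight ev₁ ev₂ m hm z.1 (w.2 - z.2)) :=
    hq.comp ((continuous_smulRight_right hmc z.1).comp (by fun_prop))
  exact (h₂.add h₃).continuousWithinAt

theorem isHypocontinuous_smulRight (hmc : Continuous fun z : X × E => m z.1 z.2)
    (hev : ∀ x, Continuous fun γ => ev₁ γ x) {ι : Type*} {V : ι → Set M} (hV : LocallyFinite V)
    (hcov : ⋃ i, V i = univ) (hc : ∀ i, IsCompact (closure (V i))) :
    IsHypocontinuous (smulRight ev₁ ev₂ m hm) :=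
  ⟨continuous_smulRight_right hmc, continuous_smulRight_left hmc,
    fun _ hB => continuousOn_smulRight_of_isVonNBounded_left hmc hev hV hcov hc hB,
    fun _ hB => continuousOn_smulRight_of_isVonNBounded_right hmc hB⟩

/-- If `E` has the neighbourhood property, then the bilinear map is continuous. -/
theorem continuous_smulRight_of_hasNeighbourhoodProperty [NoncompactSpace M]
    (hmc : Continuous fun z : X × E => m z.1 z.2) (hinj : Function.Injective ev₁)
    {ι : Type v} (h : PartitionOfUnity ι M) (hc : ∀ i, HasCompactSupport (h i))
    {L : ι → X →ₗ[ℝ] X} (hL : ∀ i, Continuous (L i))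
    (hLev : ∀ i γ x, ev₁ (L i γ) x = h i x * ev₁ γ x)
    (hE : HasNeighbourhoodProperty (compactCoveringNumber M) E) :
    Continuous fun z : TestFunctions ev₁ × E => smulRight ev₁ ev₂ m hm z.1 z.2 := by
  refine continuous_of_seminorm_bound fun q hq => ?_
  let K : ι → TopologicalSpace.Compacts M := fun i => ⟨tsupport (h i), hc i⟩
  have hLK : ∀ i γ, L i γ ∈ supportedIn ev₁ (K i) := fun i γ =>
    closure_mono fun x hx h0 => hx (by rw [hLev, h0, zero_mul])
  let L' : ∀ i, X →ₗ[ℝ] supportedIn ev₁ (K i) := fun i => (L i).codRestrict _ (hLK i)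
  choose p₁ p₂ hp₁ hp₂ hle using fun i => exists_seminorm_bound (hm := hm) hmc (K i) hq
  -- Indices with `h i = 0` are left out, since there may be more than `θ(M)` of them; for these the
  -- constant `C i = 0` below is a harmless filler.
  let J : Set ι := {i | (Function.support (h i)).Nonempty}
  have hJ : Cardinal.mk J ≤ compactCoveringNumber M :=
    LocallyFinite.mk_le_compactCoveringNumber (V := fun i : J => Function.support (h i))
      (h.locallyFinite.comp_injective Subtype.val_injective) fun i => i.2
  obtain ⟨p, hp, hdom⟩ := hE (range fun i : J => p₂ i) (by rintro _ ⟨i, rfl⟩; exact hp₂ i)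
    (Cardinal.mk_range_le_lift.trans (Cardinal.lift_le.2 hJ))
  have hC : ∀ i, ∃ C : NNReal, i ∈ J → ∀ v, p₂ i v ≤ C * p v := fun i => by
    by_cases hi : i ∈ J
    · obtain ⟨C, hC, hle⟩ := hdom _ ⟨⟨i, hi⟩, rfl⟩
      exact ⟨⟨C, hC.le⟩, fun _ => hle⟩
    · exact ⟨0, fun h => (hi h).elim⟩
  choose C hC using hC
  let s : ι → Seminorm ℝ (TestFunctions ev₁) := fun i =>
    C i • (p₁ i).comp (L i ∘ₗ toAmbient ev₁)
  have hmeet : ∀ (K : TopologicalSpace.Compacts M) (γ : supportedIn ev₁ K) (i : ι),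
      L i γ ≠ 0 → (Function.support (h i) ∩ K).Nonempty := fun K γ i hi => by
    have hne : ev₁ (L i γ) ≠ 0 := fun h0 => hi (hinj (h0.trans (map_zero _).symm))
    obtain ⟨x, hx⟩ := Function.ne_iff.1 hne
    rw [hLev] at hx
    exact ⟨x, left_ne_zero_of_mul hx, γ.2 (subset_tsupport _ (right_ne_zero_of_mul hx))⟩
  obtain ⟨Q, hQ, hQle⟩ := exists_continuous_seminorm_sum_le (s := s)
    (fun i => ((hp₁ i).comp ((hL i).comp continuous_toAmbient)).const_smul _) fun K => by
      refine (h.locallyFinite.finite_nonempty_inter_compact K.isCompact).subset fun i hi => ?_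
      obtain ⟨γ, hγ⟩ := hi
      refine hmeet K γ i fun h0 => hγ ?_
      change (C i : ℝ) * p₁ i (L i γ) = 0
      rw [h0, map_zero, mul_zero]
  refine ⟨Q, p, hQ, hp, fun γ v => ?_⟩
  obtain ⟨K₀, γ, rfl⟩ := exists_incl_eq γ
  have hT := h.locallyFinite.finite_nonempty_inter_compact K₀.isCompact
  -- Where `γ` is nonzero, the finitely many `h i` whose supports meet `K₀` already sum to `1`.
  have hsum : incl ev₁ K₀ γ = ∑ i ∈ hT.toFinset, incl ev₁ (K i) (L' i γ) := by
    refine toAmbient_injective (hinj (funext fun x => ?_))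
    simp only [map_sum, toAmbient_incl, Finset.sum_apply]
    change ev₁ γ x = ∑ i ∈ hT.toFinset, ev₁ (L i γ) x
    simp only [hLev, ← Finset.sum_mul]
    by_cases hx : ev₁ γ x = 0
    · rw [hx, mul_zero]
    · rw [h.sum_finsupport' (mem_univ x) fun i hi => ?_, one_mul]
      rw [Finite.mem_toFinset]
      exact ⟨x, (h.mem_finsupport x).1 hi, γ.2 (subset_tsupport _ hx)⟩
  calc q (smulRight ev₁ ev₂ m hm (incl ev₁ K₀ γ) v)
      ≤ ∑ i ∈ hT.toFinset, q (smulRight ev₁ ev₂ m hm (incl ev₁ (K i) (L' i γ)) v) := by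
        rw [hsum, map_sum, LinearMap.sum_apply]
        exact Finset.le_sum_of_subadditive q (map_zero q).le (map_add_le_add q) _ _
    _ ≤ ∑ i ∈ hT.toFinset, s i (incl ev₁ K₀ γ) * p v := by
        refine Finset.sum_le_sum fun i hi => (hle i _ v).trans ?_
        rw [Finite.mem_toFinset] at hi
        change p₁ i (L i γ) * p₂ i v ≤ C i * p₁ i (L i γ) * p v
        rw [mul_comm (C i : ℝ), mul_assoc]
        exact mul_le_mul_of_nonneg_left (hC i (hi.mono inter_subset_left) v) (apply_nonneg _ _)
    _ ≤ Q (incl ev₁ K₀ γ) * p v := by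
        rw [← Finset.sum_mul]
        exact mul_le_mul_of_nonneg_right (hQle _ _) (apply_nonneg _ _)

/-- Apart from formal properties of `ev₁` and `ev₂`, the order `r` enters only through the
continuity of `m` and through a compactly supported partition of unity in `X` acting on `X` by
continuous multiplications. -/
theorem smulRight_hypocontinuous_and_continuous_iff [T2Space E] [NoncompactSpace M]
    [IsTopologicalAddGroup Y] [ContinuousSMul ℝ Y] [LocallyConvexSpace ℝ Y]
    (hmc : Continuous fun z : X × E => m z.1 z.2) (hinj : Function.Injective ev₁)
    (hev₁ : ∀ x, Continuous fun γ => ev₁ γ x) (hev₂ : ∀ x, Continuous fun η => ev₂ η x)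
    {ι : Type v} (h : PartitionOfUnity ι M) (hc : ∀ i, HasCompactSupport (h i))
    (hmem : ∀ i, ∃ γ, ev₁ γ = h i) {L : ι → X →ₗ[ℝ] X} (hL : ∀ i, Continuous (L i))
    (hLev : ∀ i γ x, ev₁ (L i γ) x = h i x * ev₁ γ x) :
    IsHypocontinuous (smulRight ev₁ ev₂ m hm) ∧
    ((Continuous fun z : TestFunctions ev₁ × E => smulRight ev₁ ev₂ m hm z.1 z.2) ↔
      HasNeighbourhoodProperty (compactCoveringNumber M) E) ∧
    (TopologicalSpace.MetrizableSpace E →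
      ((Continuous fun z : TestFunctions ev₁ × E => smulRight ev₁ ev₂ m hm z.1 z.2) ↔
        IsNormable E)) := by
  have hcov : ⋃ i, Function.support (h i) = univ := univ_subset_iff.1 fun x _ => by
    obtain ⟨i, hi⟩ := h.exists_pos (mem_univ x)
    exact mem_iUnion.2 ⟨i, hi.ne'⟩
  have hne : ∀ x, ∃ γ : TestFunctions ev₁, ev₁ (toAmbient ev₁ γ) x ≠ 0 := fun x => by
    obtain ⟨i, hi⟩ := mem_iUnion.1 (hcov ▸ mem_univ x)
    obtain ⟨γ, hγ⟩ := hmem i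
    exact ⟨⟨γ, show HasCompactSupport (ev₁ γ) by rw [hγ]; exact hc i⟩,
      show ev₁ γ x ≠ 0 by rw [hγ]; exact hi⟩
  have hiff : (Continuous fun z : TestFunctions ev₁ × E => smulRight ev₁ ev₂ m hm z.1 z.2) ↔
      HasNeighbourhoodProperty (compactCoveringNumber M) E :=
    ⟨hasNeighbourhoodProperty_of_continuous_smulRight hev₂ h.locallyFinite hcov hc hne,
      continuous_smulRight_of_hasNeighbourhoodProperty hmc hinj h hc hL hLev⟩
  exact ⟨isHypocontinuous_smulRight hmc hev₁ h.locallyFinite hcov hc, hiff, fun _ =>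
    ⟨fun hcont => (hiff.1 hcont).isNormable aleph0_le_compactCoveringNumber,
      fun hn => hiff.2 (hn.hasNeighbourhoodProperty _)⟩⟩

end SMulRight

end TestFunctions

/-! ### Partitions of unity with compact supports -/

/-- The property `p` stands for the regularity demanded of the bump functions. It is assumed only
for Urysohn functions of a closed and a compact set, which suffices because the covering sets are
relatively compact. -/
theorem BumpCovering.exists_hasCompactSupport_of_prop {M : Type*} [TopologicalSpace M] [T2Space M]
    [ParacompactSpace M] [LocallyCompactSpace M] (p : (M → ℝ) → Prop)
    (h01 : ∀ s t, IsClosed s → IsCompact t → Disjoint s t →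
      ∃ f : C(M, ℝ), p f ∧ EqOn f 0 s ∧ EqOn f 1 t ∧ ∀ x, f x ∈ Icc (0 : ℝ) 1) :
    ∃ f : BumpCovering M M, (∀ i, p (f i)) ∧ ∀ i, HasCompactSupport (f i) := by
  choose K hK hxK using fun x : M => exists_compact_mem_nhds x
  obtain ⟨U, hUo, hUcov, hUf, hUK⟩ := precise_refinement (fun x => interior (K x))
    (fun _ => isOpen_interior)
    (iUnion_eq_univ_iff.2 fun x => ⟨x, mem_interior_iff_mem_nhds.2 (hxK x)⟩)
  have hUK' : ∀ i, U i ⊆ K i := fun i => (hUK i).trans interior_subset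
  -- Two shrinkings: `f i` is `1` on the closure of `W i` and `0` off `V i`, so its closed support
  -- lies in the compact closure of `V i`.
  obtain ⟨V, hVcov, hVo, hVU⟩ := exists_iUnion_eq_closure_subset hUo hUf.point_finite hUcov
  obtain ⟨W, hWcov, hWo, hWV⟩ := exists_iUnion_eq_closure_subset hVo
    (hUf.subset fun i => subset_closure.trans (hVU i)).point_finite hVcov
  have hcomp : ∀ i, IsCompact (closure (V i)) := fun i =>
    (hK i).of_isClosed_subset isClosed_closure ((hVU i).trans (hUK' i))
  choose f hfp hf0 hf1 hf01 using fun i => h01 _ _ (hVo i).isClosed_compl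
    ((hcomp i).of_isClosed_subset isClosed_closure ((hWV i).trans subset_closure))
    (disjoint_compl_left_iff_subset.2 (hWV i))
  have hsupp : ∀ i, Function.support (f i) ⊆ V i := fun i =>
    Function.support_subset_iff'.2 (hf0 i)
  refine ⟨⟨f, hUf.subset fun i => (hsupp i).trans (subset_closure.trans (hVU i)),
    fun i x => (hf01 i x).1, fun i x => (hf01 i x).2, fun x _ => ?_⟩, hfp,
    fun i => (hcomp i).of_isClosed_subset isClosed_closure (closure_mono (hsupp i))⟩
  obtain ⟨i, hi⟩ := iUnion_eq_univ_iff.1 hWcov x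
  exact ⟨i, ((hf1 i).mono subset_closure).eventuallyEq_of_mem ((hWo i).mem_nhds hi)⟩

theorem BumpCovering.hasCompactSupport_toPartitionOfUnity {ι M : Type*} [TopologicalSpace M]
    (f : BumpCovering ι M) {i : ι} (h : HasCompactSupport (f i)) :
    HasCompactSupport (f.toPartitionOfUnity i) :=
  h.mono (f.support_toPartitionOfUnity_subset i)

/-! ### Continuous functions -/

/-- Evaluation on `C(T, ℝ) × T` is jointly continuous for locally compact `T`, and currying turns
this into continuity for the compact-open topology. -/
theorem ContinuousMap.continuous_smul_const {T E : Type*} [TopologicalSpace T]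
    [LocallyCompactSpace T] [AddCommGroup E] [Module ℝ E] [TopologicalSpace E]
    [ContinuousSMul ℝ E] : Continuous fun z : C(T, ℝ) × E =>
      (⟨fun x => z.1 x • z.2, z.1.continuous.smul continuous_const⟩ : C(T, E)) := by
  refine ContinuousMap.continuous_of_continuous_uncurry _ ?_
  change Continuous fun w : (C(T, ℝ) × E) × T => w.1.1 w.2 • w.1.2
  fun_prop

theorem contPsi_hypocontinuous_and_continuous_iff {E : Type u} [AddCommGroup E] [Module ℝ E]
    [TopologicalSpace E] [IsTopologicalAddGroup E] [ContinuousSMul ℝ E] [LocallyConvexSpace ℝ E]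
    [T2Space E] (M : Type v) [TopologicalSpace M] [T2Space M] [ParacompactSpace M]
    [LocallyCompactSpace M] [NoncompactSpace M] :
    IsHypocontinuous (contPsi M E) ∧
    ((Continuous fun z : ContTestFunctions M ℝ × E => contPsi M E z.1 z.2) ↔
      HasNeighbourhoodProperty (compactCoveringNumber M) E) ∧
    (TopologicalSpace.MetrizableSpace E →
      ((Continuous fun z : ContTestFunctions M ℝ × E => contPsi M E z.1 z.2) ↔
        IsNormable E)) := by
  obtain ⟨f, -, hf⟩ := BumpCovering.exists_hasCompactSupport_of_prop (M := M) (fun _ => True)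
    fun s t hs ht hst => (exists_continuous_zero_one_of_isCompact' ht hs hst.symm).imp
      fun _ hg => ⟨trivial, hg⟩
  exact TestFunctions.smulRight_hypocontinuous_and_continuous_iff
    (L := fun i => LinearMap.mulLeft ℝ (f.toPartitionOfUnity i))
    ContinuousMap.continuous_smul_const DFunLike.coe_injective
    (fun x => continuous_eval_const x) (fun x => continuous_eval_const x) f.toPartitionOfUnity
    (fun i => f.hasCompactSupport_toPartitionOfUnity (hf i))
    (fun i => ⟨f.toPartitionOfUnity i, rfl⟩) (fun i => continuous_const.mul continuous_id)
    (fun _ _ _ => rfl)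

/-! ### Iterated partial derivatives of real-valued functions -/

section PartialDerivatives

variable {n : ℕ}

theorem hasPartialDeriv_iff_hasLineDerivAt {i : Fin n} {f : EuclideanSpace ℝ (Fin n) → ℝ} {f' : ℝ}
    {x : EuclideanSpace ℝ (Fin n)} :
    HasPartialDeriv i f f' x ↔ HasLineDerivAt ℝ f f' x (EuclideanSpace.single i (1 : ℝ)) := by
  rw [HasLineDerivAt, hasDerivAt_iff_tendsto_slope_zero]
  simp [HasPartialDeriv]

theorem HasPartialDeriv.mul {i : Fin n} {f g : EuclideanSpace ℝ (Fin n) → ℝ} {f' g' : ℝ}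
    {x : EuclideanSpace ℝ (Fin n)} (hf : HasPartialDeriv i f f' x) (hg : HasPartialDeriv i g g' x) :
    HasPartialDeriv i (fun y => f y * g y) (f' * g x + f x * g') x := by
  rw [hasPartialDeriv_iff_hasLineDerivAt] at *
  have h := HasDerivAt.mul hf hg
  simp only [zero_smul, add_zero] at h
  exact h

theorem HasPartialDeriv.list_sum {ι : Type*} {i : Fin n}
    {F : ι → EuclideanSpace ℝ (Fin n) → ℝ} {F' : ι → ℝ} {x : EuclideanSpace ℝ (Fin n)} {S : List ι}
    (h : ∀ s ∈ S, HasPartialDeriv i (F s) (F' s) x) :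
    HasPartialDeriv i (fun y => (S.map fun s => F s y).sum) (S.map F').sum x := by
  simp only [hasPartialDeriv_iff_hasLineDerivAt] at *
  induction S with
  | nil => exact hasDerivAt_const _ _
  | cons s S ih =>
    simp only [List.map_cons, List.sum_cons]
    exact HasDerivAt.add (h s List.mem_cons_self) (ih fun t ht => h t (List.mem_cons_of_mem _ ht))

theorem IsCrOn.hasPartialDeriv_sum_mul {r : ℕ∞} {U : Set (EuclideanSpace ℝ (Fin n))}
    {f g : EuclideanSpace ℝ (Fin n) → ℝ} (hf : IsCrOn r U f) (hg : IsCrOn r U g) {i : Fin n}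
    {S : List (List (Fin n) × List (Fin n))}
    (hS : ∀ s ∈ S, ((i :: s.1).length : ℕ∞) ≤ r ∧ ((i :: s.2).length : ℕ∞) ≤ r)
    {x : EuclideanSpace ℝ (Fin n)} (hx : x ∈ U) :
    HasPartialDeriv i
      (fun y => (S.map fun s => iteratedPartialDeriv s.1 f y * iteratedPartialDeriv s.2 g y).sum)
      (S.map fun s => iteratedPartialDeriv (i :: s.1) f x * iteratedPartialDeriv s.2 g x +
        iteratedPartialDeriv s.1 f x * iteratedPartialDeriv (i :: s.2) g x).sum x := by
  have h : ∀ s ∈ S, HasPartialDeriv i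
      (fun y => iteratedPartialDeriv s.1 f y * iteratedPartialDeriv s.2 g y)
      (iteratedPartialDeriv (i :: s.1) f x * iteratedPartialDeriv s.2 g x +
        iteratedPartialDeriv s.1 f x * iteratedPartialDeriv (i :: s.2) g x) x := fun s hs =>
    (hf.exists_deriv (i := i) (l := s.1) (hS s hs).1 hx).mul
      (hg.exists_deriv (i := i) (l := s.2) (hS s hs).2 hx)
  exact HasPartialDeriv.list_sum h

/-- The Leibniz rule. The list of pairs does not depend on the functions. -/
theorem exists_iteratedPartialDeriv_mul (l : List (Fin n)) :
    ∃ S : List (List (Fin n) × List (Fin n)),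
      (∀ s ∈ S, s.1.length ≤ l.length ∧ s.2.length ≤ l.length) ∧
      ∀ {r : ℕ∞} {U : Set (EuclideanSpace ℝ (Fin n))} {f g : EuclideanSpace ℝ (Fin n) → ℝ},
        IsOpen U → IsCrOn r U f → IsCrOn r U g → (l.length : ℕ∞) ≤ r →
        EqOn (iteratedPartialDeriv l fun y => f y * g y) (fun y =>
          (S.map fun s => iteratedPartialDeriv s.1 f y * iteratedPartialDeriv s.2 g y).sum) U := by
  induction l with
  | nil =>
    refine ⟨[([], [])], by simp, fun {r U f g} _ _ _ _ x _ => ?_⟩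
    simp [iteratedPartialDeriv]
  | cons i l ih =>
    obtain ⟨S, hS, h⟩ := ih
    -- The new derivative falls on either factor. Working with lists, repeated pairs account for the
    -- binomial coefficients.
    refine ⟨S.map (fun s => (i :: s.1, s.2)) ++ S.map (fun s => (s.1, i :: s.2)), ?_, ?_⟩
    · intro s hs
      rw [List.mem_append, List.mem_map, List.mem_map] at hs
      simp only [List.length_cons]
      rcases hs with ⟨t, ht, rfl⟩ | ⟨t, ht, rfl⟩
      · exact ⟨Nat.succ_le_succ (hS t ht).1, (hS t ht).2.trans (Nat.le_succ _)⟩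
      · exact ⟨(hS t ht).1.trans (Nat.le_succ _), Nat.succ_le_succ (hS t ht).2⟩
    · intro r U f g hU hf hg hl x hx
      have hl' : (l.length : ℕ∞) ≤ r := le_trans (by exact_mod_cast Nat.le_succ l.length) hl
      have hlen : ∀ k : List (Fin n), k.length ≤ l.length → ((i :: k).length : ℕ∞) ≤ r :=
        fun k hk => le_trans (by exact_mod_cast Nat.succ_le_succ hk) hl
      have hd := hf.hasPartialDeriv_sum_mul hg
        (fun s hs => ⟨hlen s.1 (hS s hs).1, hlen s.2 (hS s hs).2⟩) hx
      have e := (hd.congr_on hU hx (h hU hf hg hl')).partialDeriv_eq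
      change partialDeriv i (iteratedPartialDeriv l fun y => f y * g y) x = _
      rw [e]
      dsimp only
      rw [List.map_append, List.sum_append, List.map_map, List.map_map, ← List.sum_map_add]
      rfl

theorem IsCrOn.mul {r : ℕ∞} {U : Set (EuclideanSpace ℝ (Fin n))} (hU : IsOpen U)
    {f g : EuclideanSpace ℝ (Fin n) → ℝ} (hf : IsCrOn r U f) (hg : IsCrOn r U g) :
    IsCrOn r U fun y => f y * g y := by
  intro l hl
  obtain ⟨S, hS, h⟩ := exists_iteratedPartialDeriv_mul l
  have hle : ∀ k : List (Fin n), k.length ≤ l.length → (k.length : ℕ∞) ≤ r :=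
    fun k hk => le_trans (by exact_mod_cast hk) hl
  constructor
  · have hc : ContinuousOn (fun y => (S.map fun s =>
        iteratedPartialDeriv s.1 f y * iteratedPartialDeriv s.2 g y).sum) U :=
      continuousOn_list_sum S fun s hs => (hf s.1 (hle _ (hS s hs).1)).1.mul
        (hg s.2 (hle _ (hS s hs).2)).1
    exact hc.congr (h hU hf hg hl)
  · intro hlt i x hx
    have hlt' : ∀ k : List (Fin n), k.length ≤ l.length → ((i :: k).length : ℕ∞) ≤ r :=
      fun k hk => le_trans (by exact_mod_cast Nat.succ_le_succ hk) (Order.add_one_le_of_lt hlt)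
    have hd := hf.hasPartialDeriv_sum_mul hg
      (fun s hs => ⟨hlt' s.1 (hS s hs).1, hlt' s.2 (hS s hs).2⟩) hx
    exact ⟨_, hd.congr_on hU hx (h hU hf hg hl)⟩

theorem hasPartialDeriv_fderiv {i : Fin n} {f : EuclideanSpace ℝ (Fin n) → ℝ}
    {x : EuclideanSpace ℝ (Fin n)} (h : DifferentiableAt ℝ f x) :
    HasPartialDeriv i f (fderiv ℝ f x (EuclideanSpace.single i 1)) x :=
  hasPartialDeriv_iff_hasLineDerivAt.2 (h.hasFDerivAt.hasLineDerivAt _)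

/-- Each partial derivative uses up one order of differentiability; `k` counts the orders left over
and has to vary in the induction. -/
theorem ContDiffOn.iteratedPartialDeriv {U : Set (EuclideanSpace ℝ (Fin n))} (hU : IsOpen U)
    {f : EuclideanSpace ℝ (Fin n) → ℝ} (l : List (Fin n)) {k : ℕ}
    (h : ContDiffOn ℝ (k + l.length : ℕ) f U) :
    ContDiffOn ℝ k (iteratedPartialDeriv l f) U := by
  induction l generalizing k with
  | nil => exact h
  | cons i l ih =>
    have h1 : ContDiffOn ℝ (k + 1 : ℕ) (_root_.iteratedPartialDeriv l f) U :=
      ih (by rwa [List.length_cons, add_comm l.length, ← add_assoc] at h)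
    have h2 : ContDiffOn ℝ k (fun x => fderiv ℝ (_root_.iteratedPartialDeriv l f) x
        (EuclideanSpace.single i 1)) U :=
      (h1.fderiv_of_isOpen hU (by norm_cast)).clm_apply contDiffOn_const
    refine h2.congr fun x hx => (hasPartialDeriv_fderiv ?_).partialDeriv_eq
    exact (h1.contDiffAt (hU.mem_nhds hx)).differentiableAt (by norm_cast)

/-- No order left over (`k = 0`) gives continuity of the derivative along `l`; one order left over
(`k = 1`) gives existence of the next one. -/
theorem ContDiffOn.isCrOn {r : ℕ∞} {U : Set (EuclideanSpace ℝ (Fin n))} (hU : IsOpen U)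
    {f : EuclideanSpace ℝ (Fin n) → ℝ} (h : ContDiffOn ℝ r f U) : IsCrOn r U f := by
  intro l hl
  refine ⟨(ContDiffOn.iteratedPartialDeriv hU l (k := 0) (h.of_le ?_)).continuousOn,
    fun hlt i x hx => ⟨_, hasPartialDeriv_fderiv (((ContDiffOn.iteratedPartialDeriv hU l (k := 1)
      (h.of_le ?_)).contDiffAt (hU.mem_nhds hx)).differentiableAt (by norm_num))⟩⟩
  · rw [zero_add]
    exact_mod_cast hl
  · rw [add_comm]
    exact_mod_cast Order.add_one_le_of_lt hlt

end PartialDerivatives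

/-! ### The space of `C^r`-maps on a manifold -/

namespace CrMap

variable {r : ℕ∞} {n : ℕ} {M : Type*} {E : Type*} [TopologicalSpace M]
  [ChartedSpace (EuclideanSpace ℝ (Fin n)) M] [AddCommGroup E] [Module ℝ E] [TopologicalSpace E]
  [IsTopologicalAddGroup E] [ContinuousSMul ℝ E] [T2Space E]

/-- The iterated partial derivatives in a chart, as a linear map. -/
def chartDerivₗ (φ : OpenPartialHomeomorph M (EuclideanSpace ℝ (Fin n)))
    (hφ : φ ∈ crCharts r n M) (l : List (Fin n)) (hl : (l.length : ℕ∞) ≤ r) :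
    CrMap r n M E →ₗ[ℝ] C(φ.target, E) where
  toFun := chartDeriv φ hφ l hl
  map_add' a b := ContinuousMap.ext fun y =>
    (IsCrOn.of_op φ.open_target (fun v w : E => v + w) continuous_add
      (fun i a b a' b' x ha hb => (Tendsto.add ha hb).congr fun t => by
        rw [← smul_add, add_sub_add_comm]) (a.2 φ hφ) (b.2 φ hφ)).2 l hl y.2
  map_smul' c a := ContinuousMap.ext fun y =>
    (IsCrOn.of_op φ.open_target (fun v _ : E => c • v) (continuous_fst.const_smul c)
      (fun i a b a' b' x ha _ => (Tendsto.const_smul ha c).congr fun t => by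
        rw [smul_comm, smul_sub]) (a.2 φ hφ) (a.2 φ hφ)).2 l hl y.2

instance : IsTopologicalAddGroup (CrMap r n M E) :=
  topologicalAddGroup_iInf fun φ => topologicalAddGroup_iInf fun hφ =>
    topologicalAddGroup_iInf fun l => topologicalAddGroup_iInf fun hl =>
      topologicalAddGroup_induced (chartDerivₗ φ hφ l hl)

instance : ContinuousSMul ℝ (CrMap r n M E) :=
  continuousSMul_iInf fun φ => continuousSMul_iInf fun hφ =>
    continuousSMul_iInf fun l => continuousSMul_iInf fun hl =>
      continuousSMul_induced (chartDerivₗ φ hφ l hl)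

instance [LocallyConvexSpace ℝ E] : LocallyConvexSpace ℝ (CrMap r n M E) :=
  .iInf fun φ => .iInf fun hφ => .iInf fun l => .iInf fun hl =>
      .induced (chartDerivₗ φ hφ l hl)

theorem continuous_rng {A : Type*} [TopologicalSpace A] {f : A → CrMap r n M E}
    (h : ∀ φ hφ l hl, Continuous fun a => chartDeriv φ hφ l hl (f a)) : Continuous f :=
  continuous_iInf_rng.2 fun φ => continuous_iInf_rng.2 fun hφ => continuous_iInf_rng.2 fun l =>
    continuous_iInf_rng.2 fun hl => continuous_induced_rng.2 (h φ hφ l hl)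

theorem continuous_chartDeriv (φ : OpenPartialHomeomorph M (EuclideanSpace ℝ (Fin n)))
    (hφ : φ ∈ crCharts r n M) (l : List (Fin n)) (hl : (l.length : ℕ∞) ≤ r) :
    Continuous (chartDeriv (E := E) φ hφ l hl) :=
  continuous_iInf_dom (i := φ) <| continuous_iInf_dom (i := hφ) <| continuous_iInf_dom (i := l) <|
    continuous_iInf_dom (i := hl) continuous_induced_dom

/-- The value at `x` is the derivative of order zero in the chart at `x`, evaluated at one point. -/
theorem continuous_eval
    [IsManifold (modelWithCornersSelf ℝ (EuclideanSpace ℝ (Fin n))) r M] (x : M) :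
    Continuous fun γ => crEval r n M E γ x := by
  have hφ : chartAt (EuclideanSpace ℝ (Fin n)) x ∈ crCharts r n M :=
    IsManifold.chart_mem_maximalAtlas x
  have hx := mem_chart_target (EuclideanSpace ℝ (Fin n)) x
  have h : Continuous fun γ : CrMap r n M E => chartDeriv _ hφ [] (by simp) γ ⟨_, hx⟩ :=
    (continuous_eval_const _).comp (continuous_chartDeriv _ hφ [] (by simp))
  refine h.congr fun γ => ?_
  change crEval r n M E γ ((chartAt (EuclideanSpace ℝ (Fin n)) x).symm _) = _
  rw [OpenPartialHomeomorph.left_inv _ (mem_chart_source _ x)]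

/-- In a chart, the partial derivatives of `γ v` are those of `γ` times `v`. This reduces the claim
to continuous functions on the chart targets, which are locally compact. -/
theorem continuous_crSMulRight :
    Continuous fun z : CrMap r n M ℝ × E => crSMulRight r n M E z.1 z.2 := by
  refine continuous_rng fun φ hφ l hl => ?_
  have : LocallyCompactSpace φ.target := φ.open_target.locallyCompactSpace
  refine (ContinuousMap.continuous_smul_const.comp
    ((continuous_chartDeriv φ hφ l hl).prodMap continuous_id)).congr fun z => ?_
  refine ContinuousMap.ext fun y => Eq.symm ?_
  exact (IsCrOn.of_op φ.open_target (fun (c : ℝ) (_ : ℝ) => c • z.2)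
    (continuous_fst.smul continuous_const)
    (fun i a b a' b' x ha _ => (Tendsto.smul_const ha z.2).congr fun t => by
      rw [smul_assoc, sub_smul]) (z.1.2 φ hφ) (z.1.2 φ hφ)).2 l hl y.2

/-- Multiplication by a real-valued `C^r`-map. -/
def mulLeft (h : CrMap r n M ℝ) : CrMap r n M ℝ →ₗ[ℝ] CrMap r n M ℝ where
  toFun γ := (⟨fun x => h.1 x * γ.1 x, fun φ hφ => (h.2 φ hφ).mul φ.open_target (γ.2 φ hφ)⟩ :
    crSubmodule r n M ℝ)
  map_add' a b := Subtype.ext (funext fun x => mul_add (h.1 x) (a.1 x) (b.1 x))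
  map_smul' c a := Subtype.ext (funext fun x => mul_left_comm (h.1 x) c (a.1 x))

/-- By the Leibniz rule, each chart derivative of `h γ` is a finite sum of fixed continuous
functions times chart derivatives of `γ`. -/
theorem continuous_mulLeft (h : CrMap r n M ℝ) : Continuous (mulLeft h) := by
  refine continuous_rng fun φ hφ l hl => ?_
  have : LocallyCompactSpace φ.target := φ.open_target.locallyCompactSpace
  obtain ⟨S, hS, hmul⟩ := exists_iteratedPartialDeriv_mul l
  have hle : ∀ k : List (Fin n), k.length ≤ l.length → (k.length : ℕ∞) ≤ r :=
    fun k hk => le_trans (by exact_mod_cast hk) hl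
  -- Only for members of `S` are the lengths known to be at most `r`; the value `0` elsewhere never
  -- enters the sum.
  let g : CrMap r n M ℝ → List (Fin n) × List (Fin n) → C(φ.target, ℝ) := fun γ s =>
    if hs : s ∈ S then chartDeriv φ hφ s.1 (hle _ (hS s hs).1) h *
      chartDeriv φ hφ s.2 (hle _ (hS s hs).2) γ else 0
  have hg : Continuous fun γ => (S.map (g γ)).sum := continuous_list_sum S fun s hs => by
    simp only [dif_pos hs]
    exact continuous_const.mul (continuous_chartDeriv _ _ _ _)
  refine hg.congr fun γ => ContinuousMap.ext fun y => ?_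
  refine Eq.trans ?_ (hmul φ.open_target (h.2 φ hφ) (γ.2 φ hφ) hl y.2).symm
  have hsum : ∀ T : List (List (Fin n) × List (Fin n)),
      (T.map (g γ)).sum y = (T.map fun s => g γ s y).sum := fun T => by
    induction T with
    | nil => rfl
    | cons s T ih => simp only [List.map_cons, List.sum_cons, ContinuousMap.add_apply, ih]
  rw [hsum]
  congr 1
  refine List.map_congr_left fun s hs => ?_
  simp only [g, dif_pos hs]
  rfl

end CrMap

/-! ### `C^r` partitions of unity -/

section PartitionOfUnity

open scoped Manifold

variable {r : ℕ∞} {F : Type*} [NormedAddCommGroup F] [NormedSpace ℝ F] {H : Type*}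
  [TopologicalSpace H] {I : ModelWithCorners ℝ F H} {M : Type*} [TopologicalSpace M]
  [ChartedSpace H M]

/-- The bump function is smooth when read in the chart at `c`, whose source contains its closed
support; the chart being only `C^r`, the function is `C^r` on `M`. -/
theorem SmoothBumpFunction.contMDiff_of_isManifold [FiniteDimensional ℝ F] [T2Space M]
    [IsManifold I r M] {c : M}
    (f : SmoothBumpFunction I c) : ContMDiff I 𝓘(ℝ, ℝ) r f := by
  refine contMDiff_of_tsupport fun x hx => ?_
  have hx' : x ∈ (chartAt H c).source :=
    f.tsupport_subset_chartAt_source hx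
  refine ContMDiffAt.congr_of_eventuallyEq ?_ (f.eventuallyEq_of_mem_source hx')
  exact f.contDiffAt.contMDiffAt.comp _ (contMDiffAt_extChartAt' hx')

theorem IsCompact.exists_contMDiff_zero_one [FiniteDimensional ℝ F] [T2Space M]
    [IsManifold I r M] {s t : Set M}
    (ht : IsCompact t) (hs : IsClosed s) (hd : Disjoint s t) :
    ∃ f : M → ℝ, ContMDiff I 𝓘(ℝ, ℝ) r f ∧ EqOn f 0 s ∧ EqOn f 1 t ∧
      ∀ x, f x ∈ Icc (0 : ℝ) 1 := by
  refine ht.induction_on (p := fun t => ∃ f : M → ℝ, ContMDiff I 𝓘(ℝ, ℝ) r f ∧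
    EqOn f 0 s ∧ EqOn f 1 t ∧ ∀ x, f x ∈ Icc (0 : ℝ) 1) ?_ ?_ ?_ ?_
  · exact ⟨0, contMDiff_const, fun _ _ => rfl, eqOn_empty _ _, fun _ => ⟨le_rfl, zero_le_one⟩⟩
  · rintro t t' htt' ⟨f, hf, h0, h1, h01⟩
    exact ⟨f, hf, h0, h1.mono htt', h01⟩
  · rintro t t' ⟨f, hf, hf0, hf1, hf01⟩ ⟨g, hg, hg0, hg1, hg01⟩
    -- This combination is `1` where `f` or `g` is, `0` where both are, and stays in `[0, 1]`.
    refine ⟨fun x => 1 - (1 - f x) * (1 - g x),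
      contMDiff_const.sub ((contMDiff_const.sub hf).mul (contMDiff_const.sub hg)),
      fun x hx => ?_, fun x hx => ?_, fun x => ?_⟩
    · simp [hf0 hx, hg0 hx]
    · rcases hx with hx | hx
      · simp [hf1 hx]
      · simp [hg1 hx]
    · have h1 := hf01 x
      have h2 := hg01 x
      constructor
      · nlinarith [h1.1, h1.2, h2.1, h2.2]
      · nlinarith [h1.1, h1.2, h2.1, h2.2]
  · intro x hx
    have hxs : sᶜ ∈ 𝓝 x := hs.isOpen_compl.mem_nhds (disjoint_right.1 hd hx)
    obtain ⟨f, -, hf⟩ := (SmoothBumpFunction.nhds_basis_tsupport (I := I) x).mem_iff.1 hxs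
    refine ⟨{y | f y = 1}, nhdsWithin_le_nhds f.eventuallyEq_one, f, f.contMDiff_of_isManifold,
      fun y hy => ?_, fun y hy => hy, fun y => f.mem_Icc⟩
    by_contra hne
    exact hf (subset_tsupport _ hne) hy

/-- The partition function is `f i` times the product of `1 - f j` over the `j` preceding `i` in a
well-order; near each point only finitely many factors differ from `1`. -/
theorem BumpCovering.contMDiff_toPartitionOfUnity_of_forall {ι : Type*} {s : Set M}
    (f : BumpCovering ι M s) (hf : ∀ i, ContMDiff I 𝓘(ℝ, ℝ) r (f i)) (i : ι) :
    ContMDiff I 𝓘(ℝ, ℝ) r (f.toPartitionOfUnity i) :=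
  (hf i).mul <| (contMDiff_finprod_cond fun j _ => contMDiff_const.sub (hf j)) <| by
    simp only [Function.mulSupport_one_sub]
    exact f.locallyFinite

end PartitionOfUnity

theorem ContMDiff.mem_crSubmodule {r : ℕ∞} {n : ℕ} {M : Type*} [TopologicalSpace M]
    [ChartedSpace (EuclideanSpace ℝ (Fin n)) M] {f : M → ℝ}
    (hf : ContMDiff (modelWithCornersSelf ℝ (EuclideanSpace ℝ (Fin n)))
      (modelWithCornersSelf ℝ ℝ) r f) : f ∈ crSubmodule r n M ℝ := fun φ hφ =>
  ContDiffOn.isCrOn φ.open_target (contMDiffOn_iff_contDiffOn.1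
    (hf.comp_contMDiffOn (contMDiffOn_symm_of_mem_maximalAtlas hφ)))

theorem crPsi_hypocontinuous_and_continuous_iff {E : Type u} [AddCommGroup E] [Module ℝ E]
    [TopologicalSpace E] [IsTopologicalAddGroup E] [ContinuousSMul ℝ E] [LocallyConvexSpace ℝ E]
    [T2Space E] (r : ℕ∞) (n : ℕ) (M : Type v) [TopologicalSpace M]
    [TopologicalSpace.MetrizableSpace M] [NoncompactSpace M]
    [ChartedSpace (EuclideanSpace ℝ (Fin n)) M]
    [IsManifold (modelWithCornersSelf ℝ (EuclideanSpace ℝ (Fin n))) r M] :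
    IsHypocontinuous (crPsi r n M E) ∧
    ((Continuous fun z : CrTestFunctions r n M ℝ × E => crPsi r n M E z.1 z.2) ↔
      HasNeighbourhoodProperty (compactCoveringNumber M) E) ∧
    (TopologicalSpace.MetrizableSpace E →
      ((Continuous fun z : CrTestFunctions r n M ℝ × E => crPsi r n M E z.1 z.2) ↔
        IsNormable E)) := by
  have : LocallyCompactSpace M := ChartedSpace.locallyCompactSpace (EuclideanSpace ℝ (Fin n)) M
  have : ParacompactSpace M := by
    let := TopologicalSpace.metrizableSpaceMetric M
    infer_instance
  obtain ⟨f, hf, hfc⟩ := BumpCovering.exists_hasCompactSupport_of_prop (M := M)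
    (ContMDiff (modelWithCornersSelf ℝ (EuclideanSpace ℝ (Fin n))) (modelWithCornersSelf ℝ ℝ) r)
    fun s t hs ht hst => by
      obtain ⟨g, hg, h⟩ := ht.exists_contMDiff_zero_one (r := r)
        (I := modelWithCornersSelf ℝ (EuclideanSpace ℝ (Fin n))) hs hst
      exact ⟨⟨g, hg.continuous⟩, hg, h⟩
  let h : M → CrMap r n M ℝ := fun i =>
    (⟨f.toPartitionOfUnity i, (f.contMDiff_toPartitionOfUnity_of_forall hf i).mem_crSubmodule⟩ :
      crSubmodule r n M ℝ)
  exact TestFunctions.smulRight_hypocontinuous_and_continuous_iff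
    (L := fun i => CrMap.mulLeft (h i))
    CrMap.continuous_crSMulRight Subtype.val_injective
    CrMap.continuous_eval CrMap.continuous_eval f.toPartitionOfUnity
    (fun i => f.hasCompactSupport_toPartitionOfUnity (hfc i))
    (fun i => ⟨h i, rfl⟩) (fun i => CrMap.continuous_mulLeft (h i)) (fun _ _ _ => rfl)

end

theorem theoremB (E : Type u) [AddCommGroup E] [Module ℝ E] [TopologicalSpace E]
    [IsTopologicalAddGroup E] [ContinuousSMul ℝ E] [LocallyConvexSpace ℝ E] [T2Space E] :
    -- the case `r = 0`
    (∀ (M : Type v) [TopologicalSpace M] [T2Space M] [ParacompactSpace M]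
        [LocallyCompactSpace M] [NoncompactSpace M],
      IsHypocontinuous (contPsi M E) ∧
      ((Continuous fun z : ContTestFunctions M ℝ × E => contPsi M E z.1 z.2) ↔
        HasNeighbourhoodProperty (compactCoveringNumber M) E) ∧
      (TopologicalSpace.MetrizableSpace E →
        ((Continuous fun z : ContTestFunctions M ℝ × E => contPsi M E z.1 z.2) ↔
          IsNormable E))) ∧
    -- the case `r > 0`
    (∀ (r : ℕ∞) (_ : 0 < r) (n : ℕ) (M : Type v) [TopologicalSpace M]
        [TopologicalSpace.MetrizableSpace M] [NoncompactSpace M]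
        [ChartedSpace (EuclideanSpace ℝ (Fin n)) M]
        [IsManifold (modelWithCornersSelf ℝ (EuclideanSpace ℝ (Fin n))) r M],
      IsHypocontinuous (crPsi r n M E) ∧
      ((Continuous fun z : CrTestFunctions r n M ℝ × E => crPsi r n M E z.1 z.2) ↔
        HasNeighbourhoodProperty (compactCoveringNumber M) E) ∧
      (TopologicalSpace.MetrizableSpace E →
        ((Continuous fun z : CrTestFunctions r n M ℝ × E => crPsi r n M E z.1 z.2) ↔
          IsNormable E))) :=
  ⟨fun M => contPsi_hypocontinuous_and_continuous_iff M,
    fun r _ n M => crPsi_hypocontinuous_and_continuous_iff r n M⟩
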